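/- **Setting.** Let $d,d_1,d_2\ge 0$ be integers, let $\mathcal X\subseteq\mathbb R^d$ be bounded, and let $\Theta_1\subset\mathbb R\times\mathbb R^{d_1}\times(0,\infty)$ and $\Theta_2\subset\mathbb R\times\mathbb R^d\times\mathbb R^{d_2}\times(0,\infty)$ be compact. Let $h_1:\mathbb R^d\times\mathbb R^{d_1}\to\mathbb R$ (shared expert) and $h_2:\mathbb R^d\times\mathbb R^{d_2}\to\mathbb R$ (routed expert) be measurable in $x$ and, uniformly over $x\in\mathcal X$, bounded and Lipschitz continuous in their parameter $\kappa$, respectively $\eta$, over the values of that parameter occurring in $\Theta_1$, respectively $\Theta_2$. Let $\sigma(z)=1/(1+e^{-z})$ and let $\pi(\cdot\,|\,m,v)$ be the Gaussian density with mean $m$ and variance $v$. For $G_1=\sum_{i=1}^{k_1'}\omega_i\delta_{(\kappa_i,\tau_i)}$ with $k'_1\ge1$, $(\omega_i,\kappa_i,\tau_i)\in\Theta_1$, $\omega_i>0$, $\sum_i\omega_i=1$, and $G_2=\sum_{i=1}^{k_2'}\sigma(\beta_{0i})\delta_{(\beta_{1i},\eta_i,\nu_i)}$ with $k'_2\ge1$,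 $(\beta_{0i},\beta_{1i},\eta_i,\nu_i)\in\Theta_2$ (both given by their lists of parameters), put $$g_{G_1,G_2}(y|x)=\frac12\sum_{i=1}^{k_1'}\omega_i\,\pi(y|h_1(x,\kappa_i),\tau_i)+\frac12\sum_{i=1}^{k_2'}\frac{\sigma(\beta_{1i}^\top x+\beta_{0i})}{\sum_{j=1}^{k_2'}\sigma(\beta_{1j}^\top x+\beta_{0j})}\,\pi(y|h_2(x,\eta_i),\nu_i).$$ Let $\mathcal G_{k_1,k_2}(\Theta)$ be the set of such pairs with $k_1'\le k_1$ and $k_2'\le k_2$. Let $(G_1^*,G_2^*)$ be such a pair with $k_1^*<k_1$ shared and $k_2^*<k_2$ routed experts. Let $(X_i,Y_i)$ be i.i.d. random variables, where $X_i$ takes values in $\mathcal X$ almost surely and $Y_i$ has conditional density $g_{G_1^*,G_2^*}(\cdot|x)$ given $X_i=x$. For every $n\ge1$ let $$(\widetilde G_1^n,\widetilde G_2^n)\in\operatorname*{arg\,max}_{(G_1,G_2)\in\mathcal G_{k_1,k_2}(\Theta)}\frac1n\sum_{i=1}^n\log g_{G_1,G_2}(Y_i|X_i)\quad\text{almost surely.}$$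 **Proposition.** With $V(p,q)=\frac12\int|p-q|\,dy$ the total variation distance, $$\mathbb E_X\big[V\big(g_{\widetilde G_1^n,\widetilde G_2^n}(\cdot|X),\,g_{G_1^*,G_2^*}(\cdot|X)\big)\big]=\mathcal O_P\big(\sqrt{\log(n)/n}\big),$$ that is, for every $\varepsilon>0$ there is $M>0$ such that, for all large $n$, the left-hand side exceeds $M\sqrt{\log(n)/n}$ with probability less than $\varepsilon$ (outer probability, if the estimator is not measurable). No further restriction is placed on the ground truth. In particular the rate holds in the sparse regime, where $\beta^*_{1j}=0$ for every over-specified ground-truth routed expert $j$, i.e. every $j$ that is approximated by more than one fitted routed expert (more than one fitted $(\beta_{1i},\eta_i,\nu_i)$ lies in the Voronoi cell of $(\beta^*_{1j},\eta^*_j,\nu^*_j)$). -/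

import Mathlib

open MeasureTheory ProbabilityTheory Filter Topology
open scoped ENNReal NNReal

noncomputable section

namespace DeepSeekMoE

/-- Parameters `(ω, κ, τ)` of one shared expert. -/
abbrev SharedParam (d₁ : ℕ) : Type := ℝ × EuclideanSpace ℝ (Fin d₁) × ℝ

/-- Parameters `(β₀, β₁, η, ν)` of one routed expert. -/
abbrev RoutedParam (d d₂ : ℕ) : Type :=
  ℝ × EuclideanSpace ℝ (Fin d) × EuclideanSpace ℝ (Fin d₂) × ℝ

/-- A mixing measure `G₁ = ∑ i, ω i • δ_(κ i, τ i)`, given by its list of atoms and weights. -/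
structure SharedMixing (d₁ : ℕ) where
  size : ℕ
  atom : Fin size → SharedParam d₁

/-- A mixing measure `G₂ = ∑ i, σ (β₀ i) • δ_(β₁ i, η i, ν i)`, given by its list of atoms
and the numbers `β₀ i` that determine the weights. -/
structure RoutedMixing (d d₂ : ℕ) where
  size : ℕ
  atom : Fin size → RoutedParam d d₂

namespace SharedMixing
variable {d₁ : ℕ} (G : SharedMixing d₁) (i : Fin G.size)
/-- The weight `ω i`. -/
def omega : ℝ := (G.atom i).1
/-- The expert parameter `κ i`. -/
def kappa : EuclideanSpace ℝ (Fin d₁) := (G.atom i).2.1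
/-- The variance `τ i`. -/
def tau : ℝ := (G.atom i).2.2
end SharedMixing

namespace RoutedMixing
variable {d d₂ : ℕ} (G : RoutedMixing d d₂) (i : Fin G.size)
/-- The gating bias `β₀ i`. -/
def beta0 : ℝ := (G.atom i).1
/-- The gating vector `β₁ i`. -/
def beta1 : EuclideanSpace ℝ (Fin d) := (G.atom i).2.1
/-- The expert parameter `η i`. -/
def eta : EuclideanSpace ℝ (Fin d₂) := (G.atom i).2.2.1
/-- The variance `ν i`. -/
def nu : ℝ := (G.atom i).2.2.2
end RoutedMixing

/-- The Gaussian density with mean `m` and variance `v > 0`, at the point `y`. -/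
def gaussDensity (m v y : ℝ) : ℝ := gaussianPDFReal m v.toNNReal y

/-- Normalized sigmoid gating: the weight of the `i`-th routed expert at the input `x`. -/
def gate {d d₂ : ℕ} (G : RoutedMixing d d₂) (x : EuclideanSpace ℝ (Fin d)) (i : Fin G.size) : ℝ :=
  Real.sigmoid (inner ℝ (G.beta1 i) x + G.beta0 i) /
    ∑ j, Real.sigmoid (inner ℝ (G.beta1 j) x + G.beta0 j)

/-- The conditional density `g_{G₁,G₂}(y | x)` of the Gaussian mixture of experts with shared
experts `h₁`, routed experts `h₂` and normalized sigmoid gating. -/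
def condDensity {d d₁ d₂ : ℕ}
    (h₁ : EuclideanSpace ℝ (Fin d) → EuclideanSpace ℝ (Fin d₁) → ℝ)
    (h₂ : EuclideanSpace ℝ (Fin d) → EuclideanSpace ℝ (Fin d₂) → ℝ)
    (G : SharedMixing d₁ × RoutedMixing d d₂) (x : EuclideanSpace ℝ (Fin d)) (y : ℝ) : ℝ :=
  (1 / 2) * ∑ i, G.1.omega i * gaussDensity (h₁ x (G.1.kappa i)) (G.1.tau i) y +
  (1 / 2) * ∑ i, gate G.2 x i * gaussDensity (h₂ x (G.2.eta i)) (G.2.nu i) y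

/-- Mixing measures with at least one and at most `k` shared experts, parameters in `Θ₁`,
and positive weights that sum to one. -/
def sharedClass {d₁ : ℕ} (Θ₁ : Set (SharedParam d₁)) (k : ℕ) : Set (SharedMixing d₁) :=
  {G | 1 ≤ G.size ∧ G.size ≤ k ∧ (∀ i, G.atom i ∈ Θ₁) ∧ (∀ i, 0 < G.omega i) ∧
    ∑ i, G.omega i = 1}

/-- Mixing measures with at least one and at most `k` routed experts, parameters in `Θ₂`. -/
def routedClass {d d₂ : ℕ} (Θ₂ : Set (RoutedParam d d₂)) (k : ℕ) : Set (RoutedMixing d d₂) :=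
  {G | 1 ≤ G.size ∧ G.size ≤ k ∧ ∀ i, G.atom i ∈ Θ₂}

/-- The set of pairs `(G₁, G₂)` with at most `k₁` shared and at most `k₂` routed experts. -/
def mixingClass {d d₁ d₂ : ℕ} (Θ₁ : Set (SharedParam d₁)) (Θ₂ : Set (RoutedParam d d₂))
    (k₁ k₂ : ℕ) : Set (SharedMixing d₁ × RoutedMixing d d₂) :=
  sharedClass Θ₁ k₁ ×ˢ routedClass Θ₂ k₂

/-- The expert function `h` is measurable in the input and, uniformly over inputs `x ∈ 𝒳`, bounded
and Lipschitz continuous as a function of its parameter in `K`. -/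
structure IsRegularExpert {d m : ℕ} (h : EuclideanSpace ℝ (Fin d) → EuclideanSpace ℝ (Fin m) → ℝ)
    (𝒳 : Set (EuclideanSpace ℝ (Fin d))) (K : Set (EuclideanSpace ℝ (Fin m))) : Prop where
  measurable : ∀ θ ∈ K, Measurable fun x => h x θ
  bounded : ∃ M : ℝ, ∀ x ∈ 𝒳, ∀ θ ∈ K, |h x θ| ≤ M
  lipschitz : ∃ L : ℝ≥0, ∀ x ∈ 𝒳, LipschitzOnWith L (h x) K

/-- The law of `(X, Y)` when `X` has law `μX` and `Y` has conditional density `g x` given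
`X = x`. -/
def jointLaw {d : ℕ} (μX : Measure (EuclideanSpace ℝ (Fin d)))
    (g : EuclideanSpace ℝ (Fin d) → ℝ → ℝ) : Measure (EuclideanSpace ℝ (Fin d) × ℝ) :=
  (μX.prod volume).withDensity fun p => ENNReal.ofReal (g p.1 p.2)

/-- The normalized log-likelihood `n⁻¹ ∑ log g_{G₁,G₂}(Yᵢ | Xᵢ)` of `n` observations. -/
def logLikelihood {d d₁ d₂ : ℕ}
    (h₁ : EuclideanSpace ℝ (Fin d) → EuclideanSpace ℝ (Fin d₁) → ℝ)
    (h₂ : EuclideanSpace ℝ (Fin d) → EuclideanSpace ℝ (Fin d₂) → ℝ)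
    {n : ℕ} (x : Fin n → EuclideanSpace ℝ (Fin d)) (y : Fin n → ℝ)
    (G : SharedMixing d₁ × RoutedMixing d d₂) : ℝ :=
  (1 / (n : ℝ)) * ∑ i, Real.log (condDensity h₁ h₂ G (x i) (y i))

/-- `G` maximizes the log-likelihood over the set `𝒢`. -/
def IsMLE {d d₁ d₂ : ℕ}
    (h₁ : EuclideanSpace ℝ (Fin d) → EuclideanSpace ℝ (Fin d₁) → ℝ)
    (h₂ : EuclideanSpace ℝ (Fin d) → EuclideanSpace ℝ (Fin d₂) → ℝ)
    (𝒢 : Set (SharedMixing d₁ × RoutedMixing d d₂))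
    {n : ℕ} (x : Fin n → EuclideanSpace ℝ (Fin d)) (y : Fin n → ℝ)
    (G : SharedMixing d₁ × RoutedMixing d d₂) : Prop :=
  G ∈ 𝒢 ∧ ∀ G' ∈ 𝒢, logLikelihood h₁ h₂ x y G' ≤ logLikelihood h₁ h₂ x y G

/-- Total variation distance `½ ∫ |p - q|` between two densities on the real line. -/
def totalVariation (p q : ℝ → ℝ) : ℝ≥0∞ :=
  (1 / 2) * ∫⁻ y, ENNReal.ofReal |p y - q y|

/-- The expectation over `X ∼ μX` of the total variation distance between two conditional
densities. -/
def expectedTV {d : ℕ} (μX : Measure (EuclideanSpace ℝ (Fin d)))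
    (g g' : EuclideanSpace ℝ (Fin d) → ℝ → ℝ) : ℝ≥0∞ :=
  ∫⁻ x, totalVariation (g x) (g' x) ∂μX

/-- `A n = O_P(b n)`: for every `ε > 0` there is `M > 0` such that `P (A n > M * b n) < ε` for all
large `n`. For non-measurable `A n`, the value of `P` is the outer probability. -/
def IsBigOP {Ω : Type*} [MeasurableSpace Ω] (P : Measure Ω) (A : ℕ → Ω → ℝ≥0∞) (b : ℕ → ℝ) :
    Prop :=
  ∀ ε : ℝ, 0 < ε → ∃ M : ℝ, 0 < M ∧
    ∀ᶠ n in atTop, P {ω | ENNReal.ofReal (M * b n) < A n ω} < ENNReal.ofReal ε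

end DeepSeekMoE

end

open DeepSeekMoE

/-! The estimator is compared with the truth through densities alone, so neither identifiability nor
the position of the ground truth among over-specified experts (the sparse regime) matters. Write `p
g` for the joint density of `(X, Y)` with respect to `μX ⊗ Lebesgue`; the expected total variation
is half an `L¹` distance of such densities.

The model depends on finitely many bounded parameters and is Lipschitz in them with an integrable
envelope, a multiple of `(1 + y²)⁻¹`. Hence about `n ^ D` members `t` of the class suffice for every
`p g` to lie below some `u t = p t + F / n` whose mass is `1 + O(1/n)`
(`hasPolynomialCover_mixingClass`).

If `g` has at least the likelihood of the truth, so does the `u t` above it. For a fixed `u t`,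
Markov's inequality applied to the square root of the likelihood ratio bounds the probability of
this by the `n`-th power of the Hellinger affinity (`measure_loglik_le_le`). An `L¹` separation of
order `√(log n / n)` brings the affinity so far below `1` (`sq_affinity_le`) that this power is `O(n
^ -(D + 1))`. A union bound over the cover leaves `O(1/n)` (`exists_rate_of_cover`). Since the bound
covers all `g` at once, no measurability of the estimator is needed. -/

namespace DeepSeekMoE

/-! ### Hellinger affinity and `L¹` distance. -/

section Affinity

variable {Z : Type*} [MeasurableSpace Z] {μ : Measure Z}

theorem integrable_sqrt_mul {u p : Z → ℝ} (hu : Integrable u μ) (hp : Integrable p μ)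
    (hu0 : ∀ z, 0 ≤ u z) (hp0 : ∀ z, 0 ≤ p z) : Integrable (fun z => √(u z * p z)) μ := by
  refine Integrable.mono' (hu.add hp) ?_ (ae_of_all _ fun z => ?_)
  · exact (Real.continuous_sqrt.comp_aestronglyMeasurable
      (hu.aestronglyMeasurable.mul hp.aestronglyMeasurable))
  · rw [Real.norm_of_nonneg (Real.sqrt_nonneg _), Pi.add_apply]
    refine Real.sqrt_le_iff.2 ⟨add_nonneg (hu0 z) (hp0 z), ?_⟩
    nlinarith [mul_nonneg (hu0 z) (hp0 z), sq_nonneg (u z), sq_nonneg (p z)]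

/-- The Hellinger affinity of two nonnegative functions is controlled by their `L¹` distance. -/
theorem sq_affinity_le {u p : Z → ℝ} (hu : Integrable u μ) (hp : Integrable p μ)
    (hu0 : ∀ z, 0 ≤ u z) (hp0 : ∀ z, 0 ≤ p z) :
    (∫ z, √(u z * p z) ∂μ) ^ 2 ≤
      ((∫ z, u z ∂μ + ∫ z, p z ∂μ) ^ 2 - (∫ z, |u z - p z| ∂μ) ^ 2) / 4 := by
  have hup := integrable_sqrt_mul hu hp hu0 hp0
  have hd : Integrable (fun z => |u z - p z|) μ := (hu.sub hp).abs
  have hs : Integrable (fun z => u z + p z) μ := hu.add hp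
  set a := ∫ z, √(u z * p z) ∂μ
  set T := ∫ z, |u z - p z| ∂μ
  set s := ∫ z, u z ∂μ + ∫ z, p z ∂μ
  -- Cauchy–Schwarz for `|u - p| = |√u - √p| (√u + √p)`: the quadratic is the integral of `(t (√u +
  -- √p) - |√u - √p|)²`, and its discriminant gives `T² ≤ s² - 4 a²`.
  have key : ∀ t : ℝ, 0 ≤ (s + 2 * a) * (t * t) + (-2 * T) * t + (s - 2 * a) := by
    intro t
    have h0 : ∀ z, 0 ≤ (t * t) * (u z + p z + 2 * √(u z * p z)) + (-2 * t) * |u z - p z|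
        + (u z + p z - 2 * √(u z * p z)) := by
      intro z
      have h1 : √(u z * p z) = √(u z) * √(p z) := Real.sqrt_mul (hu0 z) _
      have h2 : |u z - p z| = |√(u z) - √(p z)| * (√(u z) + √(p z)) := by
        rw [← abs_of_nonneg (add_nonneg (Real.sqrt_nonneg (u z)) (Real.sqrt_nonneg (p z))),
          ← abs_mul]
        congr 1
        nlinarith [Real.mul_self_sqrt (hu0 z), Real.mul_self_sqrt (hp0 z)]
      have h3 := abs_mul_abs_self (√(u z) - √(p z))
      rw [h1, h2]
      have := sq_nonneg (t * (√(u z) + √(p z)) - |√(u z) - √(p z)|)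
      nlinarith [Real.mul_self_sqrt (hu0 z), Real.mul_self_sqrt (hp0 z)]
    have hA : Integrable (fun z => (t * t) * (u z + p z + 2 * √(u z * p z))) μ :=
      ((hu.add hp).add (hup.const_mul 2)).const_mul _
    have hB : Integrable (fun z => (-2 * t) * |u z - p z|) μ := hd.const_mul _
    have hC : Integrable (fun z => u z + p z - 2 * √(u z * p z)) μ :=
      (hu.add hp).sub (hup.const_mul 2)
    have hI : 0 ≤ ∫ z, ((t * t) * (u z + p z + 2 * √(u z * p z)) + (-2 * t) * |u z - p z|
        + (u z + p z - 2 * √(u z * p z))) ∂μ := integral_nonneg h0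
    have e1 : ∫ z, u z + p z + 2 * √(u z * p z) ∂μ = s + 2 * a := by
      rw [integral_add hs (hup.const_mul 2), integral_const_mul, integral_add hu hp]
    have e2 : ∫ z, u z + p z - 2 * √(u z * p z) ∂μ = s - 2 * a := by
      rw [integral_sub hs (hup.const_mul 2), integral_const_mul, integral_add hu hp]
    have hAB : Integrable (fun z => (t * t) * (u z + p z + 2 * √(u z * p z)) +
      (-2 * t) * |u z - p z|) μ := hA.add hB
    rw [integral_add hAB hC, integral_add hA hB, integral_const_mul, integral_const_mul,
      e1, e2] at hI
    linarith
  have := discrim_le_zero key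
  rw [discrim] at this
  nlinarith

end Affinity

/-! ### Exponential bound for likelihood ratios. -/

section Markov

variable {Z Ω : Type*} [MeasurableSpace Z] [MeasurableSpace Ω] {P : Measure Ω}

/-- Markov's inequality at level `1`; independence factors the expectation of the product. -/
theorem measure_one_le_prod_le {W : ℕ → Ω → Z} (hW : ∀ i, Measurable (W i))
    (hindep : iIndepFun W P) {ν : Measure Z} (hlaw : ∀ i, P.map (W i) = ν)
    {f : Z → ℝ≥0∞} (hf : Measurable f) (n : ℕ) :
    P {ω | 1 ≤ ∏ i ∈ Finset.range n, f (W i ω)} ≤ (∫⁻ z, f z ∂ν) ^ n := by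
  have h1 : ∫⁻ ω, ∏ i ∈ Finset.range n, f (W i ω) ∂P = (∫⁻ z, f z ∂ν) ^ n := by
    rw [lintegral_prod_eq_prod_lintegral_of_indepFun (Finset.range n) (fun i ω => f (W i ω))
      (hindep.comp (fun _ => f) fun _ => hf) fun i => hf.comp (hW i)]
    rw [Finset.prod_congr rfl fun i _ =>
      show ∫⁻ ω, f (W i ω) ∂P = ∫⁻ z, f z ∂ν by rw [← hlaw i, lintegral_map hf (hW i)]]
    simp
  rw [← h1]
  have := mul_meas_ge_le_lintegral (μ := P)
    (f := fun ω => ∏ i ∈ Finset.range n, f (W i ω))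
    (Finset.measurable_fun_prod _ fun i _ => hf.comp (hW i)) 1
  simpa using this

/-- Chernoff bound for the likelihood ratio of `u` against the true density `p`. -/
theorem measure_loglik_le_le {W : ℕ → Ω → Z} (hW : ∀ i, Measurable (W i))
    (hindep : iIndepFun W P) {μ : Measure Z} {u p : Z → ℝ}
    (hlaw : ∀ i, P.map (W i) = μ.withDensity fun z => ENNReal.ofReal (p z))
    (hum : Measurable u) (hpm : Measurable p)
    (hu : Integrable u μ) (hp : Integrable p μ) (hu0 : ∀ z, 0 < u z) (hp0 : ∀ z, 0 < p z)
    (n : ℕ) :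
    P {ω | ∑ i ∈ Finset.range n, Real.log (p (W i ω)) ≤
        ∑ i ∈ Finset.range n, Real.log (u (W i ω))} ≤
      ENNReal.ofReal ((∫ z, √(u z * p z) ∂μ) ^ n) := by
  have hfm : Measurable fun z => ENNReal.ofReal √(u z / p z) :=
    (hum.div hpm).sqrt.ennreal_ofReal
  -- With exponent `1/2`, the mean of the ratio's power under the true law is exactly the affinity.
  have hI : ∫⁻ z, ENNReal.ofReal √(u z / p z) ∂(μ.withDensity fun z => ENNReal.ofReal (p z)) =
      ENNReal.ofReal (∫ z, √(u z * p z) ∂μ) := by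
    rw [lintegral_withDensity_eq_lintegral_mul _ hpm.ennreal_ofReal hfm,
      ofReal_integral_eq_lintegral_ofReal
        (integrable_sqrt_mul hu hp (fun z => (hu0 z).le) fun z => (hp0 z).le)
        (ae_of_all _ fun z => Real.sqrt_nonneg _)]
    refine lintegral_congr fun z => ?_
    rw [Pi.mul_apply, ← ENNReal.ofReal_mul (hp0 z).le]
    congr 1
    have h1 : u z * p z = p z ^ 2 * (u z / p z) := by
      have := (hp0 z).ne'
      field_simp
    rw [h1, Real.sqrt_mul (sq_nonneg _), Real.sqrt_sq (hp0 z).le]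
  have := measure_one_le_prod_le hW hindep hlaw hfm n
  rw [hI, ← ENNReal.ofReal_pow (integral_nonneg fun z => Real.sqrt_nonneg _)] at this
  refine le_trans (measure_mono fun ω hω => ?_) this
  simp only [Set.mem_ofPred_eq] at hω ⊢
  rw [← ENNReal.ofReal_prod_of_nonneg fun i _ => Real.sqrt_nonneg _, ENNReal.one_le_ofReal]
  rw [← Real.log_prod fun i _ => (hp0 _).ne', ← Real.log_prod fun i _ => (hu0 _).ne',
    Real.log_le_log_iff (Finset.prod_pos fun i _ => hp0 _) (Finset.prod_pos fun i _ => hu0 _)]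
    at hω
  have h2 : ∏ i ∈ Finset.range n, √(u (W i ω) / p (W i ω)) =
      √(∏ i ∈ Finset.range n, u (W i ω) / p (W i ω)) :=
    (Real.sqrt_prod _ fun i _ => (div_pos (hu0 _) (hp0 _)).le).symm
  rw [h2, Real.one_le_sqrt, Finset.prod_div_distrib,
    one_le_div (Finset.prod_pos fun i _ => hp0 _)]
  exact hω

end Markov

/-! ### Rate of maximum likelihood from a polynomial cover. -/

section Rate

variable {Z Ω : Type*} [MeasurableSpace Z] [MeasurableSpace Ω] {P : Measure Ω}

/-- The masses are `1 + C / n` and `1`, so the hypotheses give `a² ≤ 1 + (C + C²/4 - 2 (D + 1) log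
n) / n`. With `1 + x ≤ exp x`, the `n`-th power and a square root produce `n ^ -(D + 1)`, one power
more than a union bound over `n ^ D` sets consumes. -/
theorem affinity_pow_le_of_separated {a C M T : ℝ} {D n : ℕ} (hn : 1 ≤ n) (ha : 0 ≤ a)
    (hM : 32 * (D + 1) ≤ M) (hT : M / 2 * √(Real.log n / n) ≤ T)
    (h : a ^ 2 ≤ ((1 + C / n + 1) ^ 2 - T ^ 2) / 4) :
    a ^ n ≤ Real.exp (C / 2 + C ^ 2 / 8) / (n : ℝ) ^ (D + 1) := by
  have hn1 : (1 : ℝ) ≤ n := by exact_mod_cast hn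
  have hn0 : (0 : ℝ) < n := by linarith
  have hlog : 0 ≤ Real.log n := Real.log_nonneg hn1
  have hM0 : 0 ≤ M := le_trans (by positivity) hM
  have hT2 : M ^ 2 / 4 * (Real.log n / n) ≤ T ^ 2 := by
    have h1 : (M / 2 * √(Real.log n / n)) ^ 2 ≤ T ^ 2 := pow_le_pow_left₀ (by positivity) hT 2
    rw [mul_pow, Real.sq_sqrt (by positivity)] at h1
    linarith
  have hCn : (C / n) ^ 2 ≤ C ^ 2 / n := by
    rw [div_pow]
    exact div_le_div_of_nonneg_left (sq_nonneg C) hn0 (by nlinarith)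
  have hMM : 32 * ((D : ℝ) + 1) ≤ M ^ 2 := by
    have : (0 : ℝ) ≤ D := D.cast_nonneg
    nlinarith
  have h1 : a ^ 2 ≤ 1 + ((C + C ^ 2 / 4) - 2 * (D + 1) * Real.log n) / n := by
    have h3 : 32 * ((D : ℝ) + 1) * (Real.log n / n) ≤ M ^ 2 * (Real.log n / n) :=
      mul_le_mul_of_nonneg_right hMM (by positivity)
    have h4 : ((C + C ^ 2 / 4) - 2 * (D + 1) * Real.log n) / n =
        C / n + C ^ 2 / n / 4 - 2 * (D + 1) * (Real.log n / n) := by ring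
    rw [h4]
    nlinarith
  have h2 : a ^ 2 ≤ Real.exp (((C + C ^ 2 / 4) - 2 * (D + 1) * Real.log n) / n) := by
    linarith [Real.add_one_le_exp (((C + C ^ 2 / 4) - 2 * (D + 1) * Real.log n) / n)]
  have h5 : (a ^ n) ^ 2 ≤ (Real.exp (C / 2 + C ^ 2 / 8) / (n : ℝ) ^ (D + 1)) ^ 2 := by
    calc (a ^ n) ^ 2 = (a ^ 2) ^ n := by ring
      _ ≤ Real.exp (((C + C ^ 2 / 4) - 2 * (D + 1) * Real.log n) / n) ^ n :=
        pow_le_pow_left₀ (sq_nonneg a) h2 n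
      _ = Real.exp ((C + C ^ 2 / 4) - 2 * (D + 1) * Real.log n) := by
        rw [← Real.exp_nat_mul]
        congr 1
        field_simp
      _ = (Real.exp (C / 2 + C ^ 2 / 8) / (n : ℝ) ^ (D + 1)) ^ 2 := by
        rw [← Real.exp_log (pow_pos hn0 (D + 1)), ← Real.exp_sub, ← Real.exp_nat_mul, Real.log_pow]
        congr 1
        push_cast
        ring
  exact (pow_le_pow_iff_left₀ (pow_nonneg ha n) (by positivity) two_ne_zero).1 h5

/-- Lets the cover error `C / n` be absorbed into the rate; `n ≥ 3 > e` ensures `log n ≥ 1`. -/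
theorem inv_le_sqrt_log_div {n : ℕ} (hn : 3 ≤ n) : 1 / (n : ℝ) ≤ √(Real.log n / n) := by
  have hn3 : (3 : ℝ) ≤ n := by exact_mod_cast hn
  have hlog : 1 ≤ Real.log n := by
    rw [Real.le_log_iff_exp_le (by linarith)]
    linarith [Real.exp_one_lt_d9]
  refine Real.le_sqrt_of_sq_le ?_
  rw [div_pow, one_pow, div_le_div_iff₀ (by positivity) (by linarith)]
  nlinarith

/-- Convergence rate, in `L¹`, of maximum likelihood over a class of densities that can be
covered, up to an error of order `1 / n` times an integrable envelope, by polynomially many of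
its members. -/
theorem exists_rate_of_cover {ι : Type*} {𝒢 : Set ι} {p : ι → Z → ℝ} {μ : Measure Z}
    (hmeas : ∀ g ∈ 𝒢, Measurable (p g)) (hpos : ∀ g ∈ 𝒢, ∀ z, 0 < p g z)
    (hint : ∀ g ∈ 𝒢, Integrable (p g) μ) (hone : ∀ g ∈ 𝒢, ∫ z, p g z ∂μ = 1)
    {F : Z → ℝ} (hFm : Measurable F) (hF : Integrable F μ) (hF0 : ∀ z, 0 ≤ F z)
    {S : Set Z} (hS : ∀ᵐ z ∂μ, z ∈ S) {A : ℝ} {D : ℕ}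
    (hcover : ∀ n : ℕ, 1 ≤ n → ∃ T : Finset ι, (∀ t ∈ T, t ∈ 𝒢) ∧ (T.card : ℝ) ≤ A * n ^ D ∧
      ∀ g ∈ 𝒢, ∃ t ∈ T, ∀ z ∈ S, |p g z - p t z| ≤ F z / n)
    {g₀ : ι} (hg₀ : g₀ ∈ 𝒢)
    {W : ℕ → Ω → Z} (hW : ∀ i, Measurable (W i)) (hindep : iIndepFun W P)
    (hlaw : ∀ i, P.map (W i) = μ.withDensity fun z => ENNReal.ofReal (p g₀ z)) :
    ∃ M : ℝ, 0 < M ∧ ∀ ε : ℝ, 0 < ε → ∀ᶠ n : ℕ in atTop,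
      P {ω | ∃ g ∈ 𝒢, ∑ i ∈ Finset.range n, Real.log (p g₀ (W i ω)) ≤
          ∑ i ∈ Finset.range n, Real.log (p g (W i ω)) ∧
        M * √(Real.log n / n) < ∫ z, |p g z - p g₀ z| ∂μ} < ENNReal.ofReal ε := by
  classical
  set C := ∫ z, F z ∂μ with hCdef
  have hC : 0 ≤ C := integral_nonneg hF0
  -- `4 * C` pays for the two envelope errors of size `C / n`, leaving half the separation; `32 * (D
  -- + 1)` makes the affinity bound beat the size of the cover.
  set M : ℝ := 4 * C + 32 * (D + 1) with hMdef
  have hM : 32 * ((D : ℝ) + 1) ≤ M := by linarith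
  have hM0 : 0 < M := lt_of_lt_of_le (by positivity) hM
  refine ⟨M, hM0, fun ε hε => ?_⟩
  set B := |A| * Real.exp (C / 2 + C ^ 2 / 8) with hB
  have hlim : ∀ᶠ n : ℕ in atTop, B / n < ε :=
    (tendsto_const_div_atTop_nhds_zero_nat B).eventually_lt_const hε
  filter_upwards [hlim, eventually_ge_atTop 3] with n hnB hn3
  have hn1 : 1 ≤ n := by omega
  have hn0 : (0 : ℝ) < n := by exact_mod_cast hn1
  obtain ⟨T, hT𝒢, hTcard, hT⟩ := hcover n hn1
  set b := √(Real.log n / n) with hb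
  -- On `S`, `u t` dominates every `p g` that `t` approximates, at the price of mass `1 + C / n`.
  set u : ι → Z → ℝ := fun t z => p t z + F z / n with hu
  have hum : ∀ t ∈ T, Measurable (u t) := fun t ht => (hmeas t (hT𝒢 t ht)).add (hFm.div_const _)
  have hFn : Integrable (fun z => F z / n) μ := hF.div_const _
  have hui : ∀ t ∈ T, Integrable (u t) μ := fun t ht => (hint t (hT𝒢 t ht)).add hFn
  have hupos : ∀ t ∈ T, ∀ z, 0 < u t z := fun t ht z =>
    add_pos_of_pos_of_nonneg (hpos t (hT𝒢 t ht) z) (div_nonneg (hF0 z) hn0.le)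
  have hu1 : ∀ t ∈ T, ∫ z, u t z ∂μ = 1 + C / n := fun t ht => by
    rw [hu, integral_add (hint t (hT𝒢 t ht)) hFn, hone t (hT𝒢 t ht), integral_div]
  -- Only cover elements still separated from the truth can witness the bad event.
  set R := T.filter fun t => M / 2 * b ≤ ∫ z, |u t z - p g₀ z| ∂μ with hR
  have hRT : ∀ t ∈ R, t ∈ T := fun t ht => (Finset.mem_filter.1 ht).1
  have hWS : ∀ᵐ ω ∂P, ∀ i, W i ω ∈ S := by
    rw [ae_all_iff]
    intro i
    refine ae_of_ae_map (hW i).aemeasurable (p := fun z => z ∈ S) ?_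
    rw [hlaw i]
    exact (withDensity_absolutelyContinuous _ _).ae_le hS
  have hsub : {ω | ∃ g ∈ 𝒢, ∑ i ∈ Finset.range n, Real.log (p g₀ (W i ω)) ≤
          ∑ i ∈ Finset.range n, Real.log (p g (W i ω)) ∧
        M * b < ∫ z, |p g z - p g₀ z| ∂μ} ⊆
      {ω | ¬ ∀ i, W i ω ∈ S} ∪ ⋃ t ∈ R, {ω | ∑ i ∈ Finset.range n, Real.log (p g₀ (W i ω)) ≤
        ∑ i ∈ Finset.range n, Real.log (u t (W i ω))} := by
    rintro ω ⟨g, hg, hlik, hsep⟩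
    by_cases hω : ∀ i, W i ω ∈ S
    · right
      obtain ⟨t, ht, hgt⟩ := hT g hg
      simp only [Set.mem_iUnion]
      refine ⟨t, Finset.mem_filter.2 ⟨ht, ?_⟩, ?_⟩
      · have hd : ∀ᵐ z ∂μ, |p g z - p g₀ z| ≤ |u t z - p g₀ z| + 2 * (F z / n) := by
          filter_upwards [hS] with z hz
          have h1 := hgt z hz
          have h2 : p g z - p g₀ z = (u t z - p g₀ z) + ((p g z - p t z) - F z / n) := by
            simp only [hu]; ring
          have h3 : |F z / n| = F z / n := abs_of_nonneg (div_nonneg (hF0 z) hn0.le)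
          rw [h2]
          calc _ ≤ |u t z - p g₀ z| + |(p g z - p t z) - F z / n| := abs_add_le _ _
            _ ≤ _ := by linarith [abs_sub (p g z - p t z) (F z / n)]
        have hi : Integrable (fun z => |u t z - p g₀ z|) μ := ((hui t ht).sub (hint g₀ hg₀)).abs
        have h4 := integral_mono_ae ((hint g hg).sub (hint g₀ hg₀)).abs
          (hi.add (hFn.const_mul 2)) hd
        simp only [Pi.sub_apply, Pi.add_apply] at h4
        rw [integral_add hi (hFn.const_mul 2), integral_const_mul, integral_div] at h4
        have h5 := mul_le_mul_of_nonneg_left (inv_le_sqrt_log_div hn3) hC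
        have h6 : C * (1 / (n : ℝ)) = C / n := by ring
        rw [h6] at h5
        have hb0 : 0 ≤ b := Real.sqrt_nonneg _
        have h7 : 4 * C * b ≤ M * b := mul_le_mul_of_nonneg_right
          (hMdef ▸ le_add_of_nonneg_right (by positivity)) hb0
        linarith
      · refine le_trans hlik (Finset.sum_le_sum fun i _ => ?_)
        refine Real.log_le_log (hpos g hg _) ?_
        have := (abs_le.1 (hgt _ (hω i))).2
        simp only [hu]
        linarith
    · exact Or.inl hω
  have hterm : ∀ t ∈ R, P {ω | ∑ i ∈ Finset.range n, Real.log (p g₀ (W i ω)) ≤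
        ∑ i ∈ Finset.range n, Real.log (u t (W i ω))} ≤
      ENNReal.ofReal (Real.exp (C / 2 + C ^ 2 / 8) / (n : ℝ) ^ (D + 1)) := by
    intro t ht
    have htT := hRT t ht
    refine le_trans (measure_loglik_le_le hW hindep hlaw (hum t htT) (hmeas g₀ hg₀) (hui t htT)
      (hint g₀ hg₀) (hupos t htT) (hpos g₀ hg₀) n) (ENNReal.ofReal_le_ofReal ?_)
    have h1 := sq_affinity_le (hui t htT) (hint g₀ hg₀) (fun z => (hupos t htT z).le)
      fun z => (hpos g₀ hg₀ z).le
    rw [hu1 t htT, hone g₀ hg₀] at h1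
    exact affinity_pow_le_of_separated hn1 (integral_nonneg fun z => Real.sqrt_nonneg _) hM
      (Finset.mem_filter.1 ht).2 h1
  calc _ ≤ P {ω | ¬ ∀ i, W i ω ∈ S} + P (⋃ t ∈ R, {ω | ∑ i ∈ Finset.range n,
          Real.log (p g₀ (W i ω)) ≤ ∑ i ∈ Finset.range n, Real.log (u t (W i ω))}) :=
        (measure_mono hsub).trans (measure_union_le _ _)
    _ ≤ 0 + ∑ t ∈ R, ENNReal.ofReal (Real.exp (C / 2 + C ^ 2 / 8) / (n : ℝ) ^ (D + 1)) :=
        add_le_add (ae_iff.1 hWS).le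
          ((measure_biUnion_finset_le _ _).trans (Finset.sum_le_sum hterm))
    _ = ENNReal.ofReal (R.card * (Real.exp (C / 2 + C ^ 2 / 8) / (n : ℝ) ^ (D + 1))) := by
        rw [zero_add, Finset.sum_const, nsmul_eq_mul, ENNReal.ofReal_mul (Nat.cast_nonneg _),
          ENNReal.ofReal_natCast]
    _ < ENNReal.ofReal ε := by
        refine (ENNReal.ofReal_lt_ofReal_iff hε).2 (lt_of_le_of_lt ?_ hnB)
        have h1 : (R.card : ℝ) ≤ |A| * n ^ D := by
          have h2 : (R.card : ℝ) ≤ T.card := by exact_mod_cast Finset.card_filter_le _ _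
          exact h2.trans (hTcard.trans (mul_le_mul_of_nonneg_right (le_abs_self A) (by positivity)))
        calc _ ≤ |A| * n ^ D * (Real.exp (C / 2 + C ^ 2 / 8) / (n : ℝ) ^ (D + 1)) :=
              mul_le_mul_of_nonneg_right h1 (by positivity)
          _ = B / n := by
              rw [hB, pow_succ, mul_div_assoc', div_eq_div_iff (by positivity) hn0.ne']
              ring

end Rate

/-! ### Polynomial covers of finite-dimensional families. -/

section Cover

/-- Cut coordinate space into cubes and choose one point of `S` in each cube that `S` meets. The
centres must lie in `S` itself, so that they parametrize members of the class. -/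
theorem exists_finset_cover_of_isBounded {E : Type*} [NormedAddCommGroup E] [NormedSpace ℝ E]
    [FiniteDimensional ℝ E] {S : Set E} (hS : Bornology.IsBounded S) :
    ∃ A : ℝ, ∃ D : ℕ, ∀ n : ℕ, 1 ≤ n → ∃ T : Finset E, (∀ t ∈ T, t ∈ S) ∧
      (T.card : ℝ) ≤ A * n ^ D ∧ ∀ s ∈ S, ∃ t ∈ T, ‖s - t‖ ≤ 1 / n := by
  classical
  set D := Module.finrank ℝ E
  let e : E ≃L[ℝ] (Fin D → ℝ) := ContinuousLinearEquiv.ofFinrankEq (by simp [D])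
  obtain ⟨R₀, hR₀⟩ := (hS.image (e : E →L[ℝ] (Fin D → ℝ))).exists_norm_le
  obtain ⟨R, hR⟩ := exists_nat_ge R₀
  obtain ⟨L, hL⟩ := exists_nat_ge (‖(e.symm : (Fin D → ℝ) →L[ℝ] E)‖ + 1)
  have hL1 : (1 : ℝ) ≤ L := by linarith [norm_nonneg (e.symm : (Fin D → ℝ) →L[ℝ] E)]
  have hL0 : (0 : ℝ) < L := by linarith
  refine ⟨((2 * R * L + 1 : ℕ) : ℝ) ^ D, D, fun n hn => ?_⟩
  have hn0 : (0 : ℝ) < n := by exact_mod_cast hn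
  -- Cubes of side `1 / (n L)`: the inverse coordinate map has norm at most `L`, so points of one
  -- cube are within `1 / n`.
  set q : ℕ := n * L
  have hq0 : (0 : ℝ) < q := by simp only [q]; push_cast; positivity
  let φ : E → Fin D → ℤ := fun s i => ⌊e s i * q⌋
  have hφ : ∀ s ∈ S, φ s ∈ Fintype.piFinset fun _ : Fin D =>
      Finset.Icc (-((R * q : ℕ) : ℤ)) ((R * q : ℕ) : ℤ) := by
    intro s hs
    rw [Fintype.mem_piFinset]
    intro i
    have h1 : |e s i| ≤ R :=
      ((norm_le_pi_norm (e s) i).trans (hR₀ _ (Set.mem_image_of_mem _ hs))).trans hR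
    obtain ⟨h2, h3⟩ := abs_le.1 h1
    rw [Finset.mem_Icc]
    constructor
    · rw [Int.le_floor]
      push_cast
      nlinarith
    · have : (⌊e s i * q⌋ : ℝ) ≤ ((R * q : ℕ) : ℤ) := by
        refine (Int.floor_le _).trans ?_
        push_cast
        nlinarith
      exact_mod_cast this
  have hfin : (φ '' S).Finite := (Finset.finite_toSet _).subset (by
    rintro _ ⟨s, hs, rfl⟩
    exact hφ s hs)
  have hsec : ∀ v : φ '' S, ∃ s ∈ S, φ s = v := fun v => v.2
  choose ψ hψS hψ using hsec
  have : Fintype (φ '' S) := hfin.fintype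
  refine ⟨Finset.univ.image ψ, ?_, ?_, ?_⟩
  · intro t ht
    obtain ⟨v, -, rfl⟩ := Finset.mem_image.1 ht
    exact hψS v
  · have h1 : (Finset.univ.image ψ).card ≤ ((2 * R * L + 1) * n) ^ D := by
      calc _ ≤ (Finset.univ : Finset (φ '' S)).card := Finset.card_image_le
        _ = (φ '' S).toFinset.card := by rw [Set.toFinset_card, Finset.card_univ]
        _ ≤ (Fintype.piFinset fun _ : Fin D =>
              Finset.Icc (-((R * q : ℕ) : ℤ)) ((R * q : ℕ) : ℤ)).card := by
            refine Finset.card_le_card fun v hv => ?_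
            obtain ⟨s, hs, rfl⟩ := Set.mem_toFinset.1 hv
            exact hφ s hs
        _ = (2 * (R * q) + 1) ^ D := by
            rw [Fintype.card_piFinset_const, Int.card_Icc]
            congr 1
            omega
        _ ≤ _ := by
            refine Nat.pow_le_pow_left ?_ D
            simp only [q]
            nlinarith
    calc _ ≤ ((((2 * R * L + 1) * n) ^ D : ℕ) : ℝ) := by exact_mod_cast h1
      _ = _ := by push_cast; rw [mul_pow]
  · intro s hs
    refine ⟨ψ ⟨φ s, s, hs, rfl⟩, Finset.mem_image_of_mem _ (Finset.mem_univ _), ?_⟩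
    set t := ψ ⟨φ s, s, hs, rfl⟩
    have hts : φ t = φ s := hψ _
    have h1 : ‖e s - e t‖ ≤ 1 / q := by
      rw [pi_norm_le_iff_of_nonneg (by positivity)]
      intro i
      have h2 := Int.abs_sub_lt_one_of_floor_eq_floor (congrFun hts i).symm
      rw [← sub_mul, abs_mul, abs_of_pos hq0] at h2
      rw [le_div_iff₀ hq0]
      exact h2.le
    have h3 : s - t = e.symm (e s - e t) := by simp
    rw [h3]
    calc _ ≤ ‖(e.symm : (Fin D → ℝ) →L[ℝ] E)‖ * ‖e s - e t‖ :=
          (e.symm : (Fin D → ℝ) →L[ℝ] E).le_opNorm _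
      _ ≤ L * (1 / q) := mul_le_mul (by linarith) h1 (norm_nonneg _) hL0.le
      _ = 1 / n := by
          simp only [q]
          push_cast
          field_simp

variable {ι Z : Type*}

/-- Up to errors of order `1 / n` times the envelope `F` on `S`, the functions `p g`, `g ∈ 𝒢`, are
approximated by polynomially many (in `n`) of them. -/
def HasPolynomialCover (p : ι → Z → ℝ) (S : Set Z) (F : Z → ℝ) (𝒢 : Set ι) : Prop :=
  ∃ C : ℝ, 0 ≤ C ∧ ∃ A : ℝ, ∃ D : ℕ, ∀ n : ℕ, 1 ≤ n → ∃ T : Finset ι, (∀ t ∈ T, t ∈ 𝒢) ∧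
    (T.card : ℝ) ≤ A * n ^ D ∧ ∀ g ∈ 𝒢, ∃ t ∈ T, ∀ z ∈ S, |p g z - p t z| ≤ C * F z / n

variable {p : ι → Z → ℝ} {S : Set Z} {F : Z → ℝ}

theorem hasPolynomialCover_empty : HasPolynomialCover p S F ∅ :=
  ⟨0, le_rfl, 0, 0, fun _ _ => ⟨∅, by simp, by simp, by simp⟩⟩

theorem HasPolynomialCover.union {𝒢 𝒢' : Set ι} (hF : ∀ z, 0 ≤ F z)
    (h : HasPolynomialCover p S F 𝒢) (h' : HasPolynomialCover p S F 𝒢') :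
    HasPolynomialCover p S F (𝒢 ∪ 𝒢') := by
  classical
  obtain ⟨C, hC, A, D, h⟩ := h
  obtain ⟨C', hC', A', D', h'⟩ := h'
  refine ⟨C + C', add_nonneg hC hC', |A| + |A'|, D + D', fun n hn => ?_⟩
  have hn1 : (1 : ℝ) ≤ n := by exact_mod_cast hn
  obtain ⟨T, hT, hcard, hcov⟩ := h n hn
  obtain ⟨T', hT', hcard', hcov'⟩ := h' n hn
  refine ⟨T ∪ T', ?_, ?_, ?_⟩
  · intro t ht
    exact (Finset.mem_union.1 ht).imp (hT t) (hT' t)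
  · have h1 : ((T ∪ T').card : ℝ) ≤ T.card + T'.card := by
      exact_mod_cast Finset.card_union_le _ _
    have h2 : A * (n : ℝ) ^ D ≤ |A| * n ^ (D + D') :=
      mul_le_mul (le_abs_self A) (pow_le_pow_right₀ hn1 (by omega)) (by positivity) (abs_nonneg A)
    have h3 : A' * (n : ℝ) ^ D' ≤ |A'| * n ^ (D + D') :=
      mul_le_mul (le_abs_self A') (pow_le_pow_right₀ hn1 (by omega)) (by positivity)
        (abs_nonneg A')
    linarith
  · rintro g (hg | hg)
    · obtain ⟨t, ht, hgt⟩ := hcov g hg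
      refine ⟨t, Finset.mem_union_left _ ht, fun z hz => (hgt z hz).trans ?_⟩
      have := hF z
      gcongr
      linarith
    · obtain ⟨t, ht, hgt⟩ := hcov' g hg
      refine ⟨t, Finset.mem_union_right _ ht, fun z hz => (hgt z hz).trans ?_⟩
      have := hF z
      gcongr
      linarith

theorem HasPolynomialCover.biUnion {J : Type*} (s : Finset J) {𝒢 : J → Set ι}
    (hF : ∀ z, 0 ≤ F z) (h : ∀ j ∈ s, HasPolynomialCover p S F (𝒢 j)) :
    HasPolynomialCover p S F (⋃ j ∈ s, 𝒢 j) := by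
  classical
  induction s using Finset.induction_on with
  | empty => simpa using hasPolynomialCover_empty
  | insert j s _ ih =>
    rw [Finset.set_biUnion_insert]
    exact (h j (Finset.mem_insert_self j s)).union hF
      (ih fun i hi => h i (Finset.mem_insert_of_mem hi))

theorem HasPolynomialCover.image {E : Type*} [NormedAddCommGroup E] [NormedSpace ℝ E]
    [FiniteDimensional ℝ E] {B : Set E} (hB : Bornology.IsBounded B) (Φ : E → ι) {C : ℝ}
    (hC : 0 ≤ C) (hF : ∀ z, 0 ≤ F z)
    (h : ∀ s ∈ B, ∀ t ∈ B, ∀ z ∈ S, |p (Φ s) z - p (Φ t) z| ≤ C * ‖s - t‖ * F z) :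
    HasPolynomialCover p S F (Φ '' B) := by
  classical
  obtain ⟨A, D, hcov⟩ := exists_finset_cover_of_isBounded hB
  refine ⟨C, hC, A, D, fun n hn => ?_⟩
  obtain ⟨T, hT, hcard, hT'⟩ := hcov n hn
  refine ⟨T.image Φ, ?_, ?_, ?_⟩
  · intro t ht
    obtain ⟨s, hs, rfl⟩ := Finset.mem_image.1 ht
    exact Set.mem_image_of_mem Φ (hT s hs)
  · exact le_trans (by exact_mod_cast Finset.card_image_le) hcard
  · rintro _ ⟨s, hs, rfl⟩
    obtain ⟨t, ht, hst⟩ := hT' s hs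
    refine ⟨Φ t, Finset.mem_image_of_mem Φ ht, fun z hz => (h s hs t (hT t ht) z hz).trans ?_⟩
    calc C * ‖s - t‖ * F z ≤ C * (1 / n) * F z :=
          mul_le_mul_of_nonneg_right (mul_le_mul_of_nonneg_left hst hC) (hF z)
      _ = C * F z / n := by ring

end Cover

/-! ### Lipschitz dependence of the Gaussian density on mean and variance. -/

section Gaussian

theorem gaussDensity_eq_exp {m v : ℝ} (hv : 0 < v) (y : ℝ) :
    gaussDensity m v y = Real.exp (-(Real.log (2 * Real.pi * v) / 2) - (y - m) ^ 2 / (2 * v)) := by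
  have h : 0 < 2 * Real.pi * v := by positivity
  rw [gaussDensity, gaussianPDFReal, Real.coe_toNNReal v hv.le, Real.exp_sub, Real.exp_neg,
    Real.exp_half, Real.exp_log h, neg_div, Real.exp_neg]
  exact (div_eq_mul_inv _ _).symm

theorem gaussDensity_pos {m v : ℝ} (hv : 0 < v) (y : ℝ) : 0 < gaussDensity m v y :=
  gaussianPDFReal_pos _ _ _ (Real.toNNReal_pos.2 hv).ne'

/-- With `t = c y²`, the bound `exp t ≥ 1 + t + t²/2` gives `(1 + t)² ≤ 2 exp t`, and `1 + y² ≤ (1 +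
1/c) (1 + t)`. -/
theorem one_add_sq_sq_mul_exp_le {c : ℝ} (hc : 0 < c) (y : ℝ) :
    (1 + y ^ 2) ^ 2 * Real.exp (-(c * y ^ 2)) ≤ 2 * (1 + 1 / c) ^ 2 := by
  have h0 : 0 ≤ c * y ^ 2 := by positivity
  have h1 : (1 + c * y ^ 2) ^ 2 ≤ 2 * Real.exp (c * y ^ 2) := by
    nlinarith [Real.quadratic_le_exp_of_nonneg h0]
  have h2 : 1 + y ^ 2 ≤ (1 + 1 / c) * (1 + c * y ^ 2) := by
    have : (1 + 1 / c) * (1 + c * y ^ 2) = 1 + y ^ 2 + (1 / c + c * y ^ 2) := by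
      field_simp
      ring
    rw [this]
    have : 0 < 1 / c := by positivity
    linarith
  rw [Real.exp_neg, ← div_eq_mul_inv, div_le_iff₀ (Real.exp_pos _)]
  calc (1 + y ^ 2) ^ 2 ≤ ((1 + 1 / c) * (1 + c * y ^ 2)) ^ 2 :=
        pow_le_pow_left₀ (by positivity) h2 2
    _ = (1 + 1 / c) ^ 2 * (1 + c * y ^ 2) ^ 2 := by ring
    _ ≤ (1 + 1 / c) ^ 2 * (2 * Real.exp (c * y ^ 2)) :=
        mul_le_mul_of_nonneg_left h1 (sq_nonneg _)
    _ = _ := by ring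

/-- Of the two factors `1 + y²`, one will absorb the growth of the log-density's increments; the
other remains as the integrable envelope. -/
theorem exists_gaussDensity_le {a : ℝ} (ha : 0 < a) (b B : ℝ) :
    ∃ C : ℝ, 0 ≤ C ∧ ∀ m v y : ℝ, |m| ≤ B → a ≤ v → v ≤ b →
      gaussDensity m v y * (1 + y ^ 2) ^ 2 ≤ C := by
  rcases lt_or_ge b a with hab | hab
  · exact ⟨0, le_rfl, fun m v y _ h h' => absurd (h.trans h') (not_le.2 hab)⟩
  have hb : 0 < b := ha.trans_le hab
  refine ⟨Real.exp (-(Real.log (2 * Real.pi * a) / 2) + B ^ 2 / (2 * b)) *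
    (2 * (1 + 1 / (1 / (4 * b))) ^ 2), by positivity, fun m v y hm hav hvb => ?_⟩
  have hv : 0 < v := ha.trans_le hav
  have hπ := Real.pi_pos
  have h1 : Real.log (2 * Real.pi * a) ≤ Real.log (2 * Real.pi * v) :=
    Real.log_le_log (by positivity) (by gcongr)
  -- The difference of `(y - m)²` and `y²/2 - m²` is `(y - 2m)² / 2`.
  have h2 : y ^ 2 / 2 - B ^ 2 ≤ (y - m) ^ 2 := by
    have : m ^ 2 ≤ B ^ 2 := sq_le_sq' (abs_le.1 hm).1 (abs_le.1 hm).2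
    nlinarith [sq_nonneg (y - 2 * m)]
  have h3 : (y ^ 2 / 2 - B ^ 2) / (2 * b) ≤ (y - m) ^ 2 / (2 * v) :=
    calc _ ≤ (y - m) ^ 2 / (2 * b) := by gcongr
      _ ≤ _ := by gcongr
  have h4 : gaussDensity m v y ≤ Real.exp (-(Real.log (2 * Real.pi * a) / 2) + B ^ 2 / (2 * b)) *
      Real.exp (-(1 / (4 * b) * y ^ 2)) := by
    rw [gaussDensity_eq_exp hv, ← Real.exp_add]
    refine Real.exp_le_exp.2 ?_
    have : (y ^ 2 / 2 - B ^ 2) / (2 * b) = 1 / (4 * b) * y ^ 2 - B ^ 2 / (2 * b) := by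
      field_simp
      ring
    linarith
  calc _ ≤ Real.exp (-(Real.log (2 * Real.pi * a) / 2) + B ^ 2 / (2 * b)) *
      Real.exp (-(1 / (4 * b) * y ^ 2)) * (1 + y ^ 2) ^ 2 := by gcongr
    _ = Real.exp (-(Real.log (2 * Real.pi * a) / 2) + B ^ 2 / (2 * b)) *
      ((1 + y ^ 2) ^ 2 * Real.exp (-(1 / (4 * b) * y ^ 2))) := by ring
    _ ≤ _ := mul_le_mul_of_nonneg_left (one_add_sq_sq_mul_exp_le (by positivity) y)
        (Real.exp_nonneg _)

/-- The tangent of `exp` at `s` lies below the graph. One-sided; exchanging the arguments gives the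
absolute value later. -/
theorem exp_sub_exp_le (s t : ℝ) : Real.exp s - Real.exp t ≤ Real.exp s * |s - t| := by
  have h1 : Real.exp t = Real.exp s * Real.exp (t - s) := by rw [← Real.exp_add]; congr 1; ring
  have h2 := Real.add_one_le_exp (t - s)
  rw [h1]
  nlinarith [Real.exp_pos s, le_abs_self (s - t)]

theorem log_sub_log_le {a v v' : ℝ} (ha : 0 < a) (hv : a ≤ v) (hv' : a ≤ v') :
    Real.log v - Real.log v' ≤ |v - v'| / a := by
  have h0 : 0 < v := ha.trans_le hv
  have h0' : 0 < v' := ha.trans_le hv'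
  rw [← Real.log_div h0.ne' h0'.ne']
  calc _ ≤ v / v' - 1 := Real.log_le_sub_one_of_pos (div_pos h0 h0')
    _ = (v - v') / v' := by field_simp
    _ ≤ |v - v'| / v' := by gcongr; exact le_abs_self _
    _ ≤ _ := by gcongr

/-- The parameter derivatives of the log-density are at most quadratic in `y` once means are bounded
and variances stay away from `0`. -/
theorem exists_log_gaussDensity_lipschitz {a : ℝ} (ha : 0 < a) {B : ℝ} (hB : 0 ≤ B) :
    ∃ Q : ℝ, 0 ≤ Q ∧ ∀ m m' v v' y : ℝ, |m| ≤ B → |m'| ≤ B → a ≤ v → a ≤ v' →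
      |(-(Real.log (2 * Real.pi * v) / 2) - (y - m) ^ 2 / (2 * v)) -
        (-(Real.log (2 * Real.pi * v') / 2) - (y - m') ^ 2 / (2 * v'))| ≤
        Q * (|m - m'| + |v - v'|) * (1 + y ^ 2) := by
  refine ⟨1 / a + 3 * (1 + B ^ 2) / a + (1 + B ^ 2) / a ^ 2, by positivity,
    fun m m' v v' y hm hm' hv hv' => ?_⟩
  have h0 : 0 < v := ha.trans_le hv
  have h0' : 0 < v' := ha.trans_le hv'
  have hπ := Real.pi_pos
  have hy := abs_nonneg y
  have hy2 : |y| ^ 2 = y ^ 2 := sq_abs y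
  have e1 : Real.log (2 * Real.pi * v) = Real.log (2 * Real.pi) + Real.log v :=
    Real.log_mul (by positivity) h0.ne'
  have e2 : Real.log (2 * Real.pi * v') = Real.log (2 * Real.pi) + Real.log v' :=
    Real.log_mul (by positivity) h0'.ne'
  have i1 : |Real.log v' - Real.log v| ≤ |v - v'| / a := by
    rw [abs_le]
    have := log_sub_log_le ha hv hv'
    have h := log_sub_log_le ha hv' hv
    rw [abs_sub_comm] at h
    constructor <;> linarith
  have i2 : |(m - m') * (2 * y - m - m') / (2 * v)| ≤
      |m - m'| * (3 * (1 + B ^ 2) / a * (1 + y ^ 2)) := by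
    rw [mul_div_assoc, abs_mul]
    refine mul_le_mul_of_nonneg_left ?_ (abs_nonneg _)
    rw [abs_div, abs_of_pos (show 0 < 2 * v by positivity)]
    have j1 : |2 * y - m - m'| ≤ 2 * (|y| + B) := by
      rw [abs_le] at hm hm' ⊢
      constructor <;> linarith [le_abs_self y, neg_abs_le y]
    calc _ ≤ 2 * (|y| + B) / (2 * a) := by gcongr
      _ = (|y| + B) / a := by field_simp
      _ ≤ 3 * (1 + B ^ 2) * (1 + y ^ 2) / a := by
          gcongr
          nlinarith [sq_nonneg (|y| - 1), sq_nonneg (B - 1), sq_nonneg (B * y)]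
      _ = _ := by ring
  have i3 : |(y - m') ^ 2 * (v - v') / (2 * v * v')| ≤
      |v - v'| * ((1 + B ^ 2) / a ^ 2 * (1 + y ^ 2)) := by
    rw [mul_comm, mul_div_assoc, abs_mul]
    refine mul_le_mul_of_nonneg_left ?_ (abs_nonneg _)
    rw [abs_of_nonneg (by positivity)]
    have j1 : (y - m') ^ 2 ≤ 2 * (1 + B ^ 2) * (1 + y ^ 2) := by
      have : m' ^ 2 ≤ B ^ 2 := sq_le_sq' (abs_le.1 hm').1 (abs_le.1 hm').2
      nlinarith [sq_nonneg (y + m'), sq_nonneg (B * y)]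
    calc _ ≤ 2 * (1 + B ^ 2) * (1 + y ^ 2) / (2 * a * a) := by gcongr
      _ = _ := by field_simp
  -- Change the mean at variance `v`, then the variance at mean `m'`.
  have e3 : (-(Real.log (2 * Real.pi * v) / 2) - (y - m) ^ 2 / (2 * v)) -
        (-(Real.log (2 * Real.pi * v') / 2) - (y - m') ^ 2 / (2 * v')) =
      (Real.log v' - Real.log v) / 2 + (m - m') * (2 * y - m - m') / (2 * v) +
        (y - m') ^ 2 * (v - v') / (2 * v * v') := by
    rw [e1, e2]
    field_simp
    ring
  rw [e3]
  have i4 : |(Real.log v' - Real.log v) / 2| ≤ |v - v'| * (1 / a * (1 + y ^ 2)) := by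
    rw [abs_div, abs_two]
    have j1 : |v - v'| / a * 1 ≤ |v - v'| / a * (1 + y ^ 2) :=
      mul_le_mul_of_nonneg_left (by nlinarith) (by positivity)
    have j2 : |v - v'| * (1 / a * (1 + y ^ 2)) = |v - v'| / a * (1 + y ^ 2) := by ring
    linarith [abs_nonneg (Real.log v' - Real.log v)]
  have p1 : 0 ≤ |m - m'| * (1 / a * (1 + y ^ 2)) := by positivity
  have p2 : 0 ≤ |m - m'| * ((1 + B ^ 2) / a ^ 2 * (1 + y ^ 2)) := by positivity
  have p3 : 0 ≤ |v - v'| * (3 * (1 + B ^ 2) / a * (1 + y ^ 2)) := by positivity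
  refine (abs_add_three _ _ _).trans ?_
  linarith

theorem exists_gaussDensity_lipschitz {a : ℝ} (ha : 0 < a) (b : ℝ) {B : ℝ} (hB : 0 ≤ B) :
    ∃ C : ℝ, 0 ≤ C ∧
      (∀ m v y : ℝ, |m| ≤ B → a ≤ v → v ≤ b → |gaussDensity m v y| ≤ C * (1 + y ^ 2)⁻¹) ∧
      ∀ m m' v v' y : ℝ, |m| ≤ B → |m'| ≤ B → a ≤ v → v ≤ b → a ≤ v' → v' ≤ b →
        |gaussDensity m v y - gaussDensity m' v' y| ≤
          C * (|m - m'| + |v - v'|) * (1 + y ^ 2)⁻¹ := by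
  obtain ⟨K, hK, hKb⟩ := exists_gaussDensity_le ha b B
  obtain ⟨Q, hQ, hQb⟩ := exists_log_gaussDensity_lipschitz ha hB
  refine ⟨K + K * Q, by positivity, fun m v y hm hav hvb => ?_,
    fun m m' v v' y hm hm' hav hvb hav' hvb' => ?_⟩
  · have hg := gaussDensity_pos (m := m) (ha.trans_le hav) y
    rw [abs_of_pos hg, ← div_eq_mul_inv, le_div_iff₀ (by positivity)]
    have h1 := hKb m v y hm hav hvb
    have h2 : gaussDensity m v y * (1 + y ^ 2) ≤ gaussDensity m v y * (1 + y ^ 2) ^ 2 :=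
      mul_le_mul_of_nonneg_left (by nlinarith [sq_nonneg y]) hg.le
    nlinarith [mul_nonneg hK hQ]
  · have key : ∀ m m' v v' : ℝ, |m| ≤ B → |m'| ≤ B → a ≤ v → v ≤ b → a ≤ v' → v' ≤ b →
        gaussDensity m v y - gaussDensity m' v' y ≤
          (K + K * Q) * (|m - m'| + |v - v'|) * (1 + y ^ 2)⁻¹ := by
      intro m m' v v' hm hm' hav hvb hav' hvb'
      have hg := gaussDensity_pos (m := m) (ha.trans_le hav) y
      have h1 := exp_sub_exp_le (-(Real.log (2 * Real.pi * v) / 2) - (y - m) ^ 2 / (2 * v))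
        (-(Real.log (2 * Real.pi * v') / 2) - (y - m') ^ 2 / (2 * v'))
      rw [← gaussDensity_eq_exp (ha.trans_le hav), ← gaussDensity_eq_exp (ha.trans_le hav')] at h1
      have h2 := mul_le_mul_of_nonneg_left (hQb m m' v v' y hm hm' hav hav') hg.le
      have h3 := mul_le_mul_of_nonneg_right (hKb m v y hm hav hvb)
        (show 0 ≤ Q * (|m - m'| + |v - v'|) by positivity)
      rw [← div_eq_mul_inv, le_div_iff₀ (by positivity)]
      have h4 := mul_le_mul_of_nonneg_right (h1.trans h2) (show 0 ≤ 1 + y ^ 2 by positivity)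
      have h5 : 0 ≤ K * (|m - m'| + |v - v'|) := by positivity
      linarith
    rw [abs_le]
    have h1 := key m m' v v' hm hm' hav hvb hav' hvb'
    have h2 := key m' m v' v hm' hm hav' hvb' hav hvb
    rw [abs_sub_comm m' m, abs_sub_comm v' v] at h2
    constructor <;> linarith

end Gaussian

/-! ### Lipschitz dependence of gates and mixtures on their parameters. -/

section Lipschitz

theorem abs_sum_mul_sub_sum_mul_le {k : ℕ} {α α' g g' : Fin k → ℝ} {a r q s : ℝ}
    (hα : ∀ i, |α i - α' i| ≤ a) (hα' : ∀ i, |α' i| ≤ r) (hg : ∀ i, |g i| ≤ q)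
    (hg' : ∀ i, |g i - g' i| ≤ s) :
    |∑ i, α i * g i - ∑ i, α' i * g' i| ≤ k * (a * q + r * s) := by
  rw [← Finset.sum_sub_distrib]
  refine (Finset.abs_sum_le_sum_abs _ _).trans ?_
  have : ∀ i ∈ (Finset.univ : Finset (Fin k)), |α i * g i - α' i * g' i| ≤ a * q + r * s := by
    intro i _
    have h1 : α i * g i - α' i * g' i = (α i - α' i) * g i + α' i * (g i - g' i) := by ring
    rw [h1]
    refine (abs_add_le _ _).trans ?_
    rw [abs_mul, abs_mul]
    exact add_le_add
      (mul_le_mul (hα i) (hg i) (abs_nonneg _) ((abs_nonneg _).trans (hα i)))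
      (mul_le_mul (hα' i) (hg' i) (abs_nonneg _) ((abs_nonneg _).trans (hα' i)))
  simpa [mul_add] using Finset.sum_le_sum this

theorem abs_div_sum_sub_div_sum_le {k : ℕ} {w w' : Fin k → ℝ} {c δ : ℝ} (hc : 0 < c)
    (hw : ∀ i, c ≤ w i) (hw' : ∀ i, 0 < w' i) (h : ∀ i, |w i - w' i| ≤ δ) (i : Fin k) :
    |w i / ∑ j, w j - w' i / ∑ j, w' j| ≤ (k + 1) * δ / c := by
  have hs : w i ≤ ∑ j, w j :=
    Finset.single_le_sum (fun j _ => hc.le.trans (hw j)) (Finset.mem_univ i)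
  have hs' : w' i ≤ ∑ j, w' j :=
    Finset.single_le_sum (fun j _ => (hw' j).le) (Finset.mem_univ i)
  have hss : |∑ j, w j - ∑ j, w' j| ≤ k * δ := by
    rw [← Finset.sum_sub_distrib]
    refine (Finset.abs_sum_le_sum_abs _ _).trans ?_
    simpa using Finset.sum_le_sum fun j (_ : j ∈ (Finset.univ : Finset (Fin k))) => h j
  set s := ∑ j, w j
  set s' := ∑ j, w' j
  have hcs : c ≤ s := (hw i).trans hs
  have hs0 : 0 < s := hc.trans_le hcs
  have hs0' : 0 < s' := (hw' i).trans_le hs'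
  -- Only `s` remains as an outer denominator, and `w' i / s' ≤ 1`; hence the lower bound `c` is
  -- needed for `w` alone.
  have e : w i / s - w' i / s' = ((w i - w' i) - w' i / s' * (s - s')) / s := by
    field_simp
    ring
  have hr : |w' i / s'| ≤ 1 := by
    rw [abs_of_pos (div_pos (hw' i) hs0'), div_le_one hs0']
    exact hs'
  have hδ : 0 ≤ δ := (abs_nonneg _).trans (h i)
  rw [e, abs_div, abs_of_pos hs0]
  have hnum : |(w i - w' i) - w' i / s' * (s - s')| ≤ (k + 1) * δ := by
    refine (abs_sub _ _).trans ?_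
    rw [abs_mul]
    have := mul_le_mul hr hss (abs_nonneg _) zero_le_one
    linarith [h i]
  gcongr

theorem abs_sigmoid_sub_le (s t : ℝ) : |Real.sigmoid s - Real.sigmoid t| ≤ |s - t| := by
  have h : ∀ z ∈ (Set.univ : Set ℝ), ‖deriv Real.sigmoid z‖ ≤ 1 := by
    intro z _
    have h0 := Real.sigmoid_pos z
    have h1 := Real.sigmoid_lt_one z
    rw [Real.deriv_sigmoid, Real.norm_of_nonneg (mul_nonneg h0.le (by linarith))]
    nlinarith
  have := Convex.norm_image_sub_le_of_norm_deriv_le (fun z _ => differentiable_sigmoid z) h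
    convex_univ (Set.mem_univ t) (Set.mem_univ s)
  simpa using this

variable {d m : ℕ} {h : EuclideanSpace ℝ (Fin d) → EuclideanSpace ℝ (Fin m) → ℝ}
  {𝒳 : Set (EuclideanSpace ℝ (Fin d))} {K : Set (EuclideanSpace ℝ (Fin m))}

theorem IsRegularExpert.exists_gaussDensity_lipschitz (hh : IsRegularExpert h 𝒳 K) {a : ℝ}
    (ha : 0 < a) (b : ℝ) :
    ∃ C : ℝ, 0 ≤ C ∧ ∀ x ∈ 𝒳, ∀ θ ∈ K, ∀ θ' ∈ K, ∀ v v' δ y : ℝ, a ≤ v → v ≤ b → a ≤ v' → v' ≤ b →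
      ‖θ - θ'‖ ≤ δ → |v - v'| ≤ δ → |gaussDensity (h x θ) v y| ≤ C * (1 + y ^ 2)⁻¹ ∧
      |gaussDensity (h x θ) v y - gaussDensity (h x θ') v' y| ≤ C * δ * (1 + y ^ 2)⁻¹ := by
  obtain ⟨M, hM⟩ := hh.bounded
  obtain ⟨L, hL⟩ := hh.lipschitz
  obtain ⟨C, hC, hb, hl⟩ := DeepSeekMoE.exists_gaussDensity_lipschitz ha b (abs_nonneg M)
  have hM' : ∀ x ∈ 𝒳, ∀ θ ∈ K, |h x θ| ≤ |M| := fun x hx θ hθ =>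
    (hM x hx θ hθ).trans (le_abs_self M)
  refine ⟨C * (L + 1), by positivity, fun x hx θ hθ θ' hθ' v v' δ y hv hvb hv' hvb' hθδ hvδ =>
    ⟨(hb _ _ _ (hM' x hx θ hθ) hv hvb).trans ?_,
      (hl _ _ _ _ _ (hM' x hx θ hθ) (hM' x hx θ' hθ') hv hvb hv' hvb').trans ?_⟩⟩
  · gcongr
    nlinarith [L.coe_nonneg]
  · have h1 : |h x θ - h x θ'| ≤ L * δ := by
      have := (hL x hx).norm_sub_le hθ hθ'
      rw [Real.norm_eq_abs] at this
      exact this.trans (mul_le_mul_of_nonneg_left hθδ L.coe_nonneg)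
    calc _ ≤ C * (L * δ + δ) * (1 + y ^ 2)⁻¹ := by gcongr
      _ = _ := by ring

/-- Compactness bounds weights and variances above and keeps variances away from `0`. The parameter
space carries the sup norm, so every component moves by at most `‖s - t‖`. -/
theorem exists_shared_lipschitz {d₁ : ℕ}
    {h₁ : EuclideanSpace ℝ (Fin d) → EuclideanSpace ℝ (Fin d₁) → ℝ} {Θ₁ : Set (SharedParam d₁)}
    (hΘ₁ : IsCompact Θ₁) (hτ : ∀ θ ∈ Θ₁, 0 < θ.2.2)
    (hh₁ : IsRegularExpert h₁ 𝒳 ((fun θ : SharedParam d₁ => θ.2.1) '' Θ₁)) (k : ℕ) :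
    ∃ C : ℝ, 0 ≤ C ∧ ∀ s t : Fin k → SharedParam d₁, (∀ i, s i ∈ Θ₁) → (∀ i, t i ∈ Θ₁) →
      ∀ x ∈ 𝒳, ∀ y : ℝ,
        |∑ i, (s i).1 * gaussDensity (h₁ x (s i).2.1) (s i).2.2 y -
          ∑ i, (t i).1 * gaussDensity (h₁ x (t i).2.1) (t i).2.2 y| ≤
        C * ‖s - t‖ * (1 + y ^ 2)⁻¹ := by
  obtain ⟨a, ha, haΘ⟩ := hΘ₁.exists_forall_le'
    (f := fun θ : SharedParam d₁ => θ.2.2) (by fun_prop) hτ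
  obtain ⟨R, hR⟩ := hΘ₁.isBounded.exists_norm_le
  have hv : ∀ θ ∈ Θ₁, θ.2.2 ≤ |R| := fun θ hθ => (le_abs_self _).trans
    ((norm_snd_le θ.2).trans ((norm_snd_le θ).trans ((hR θ hθ).trans (le_abs_self R))))
  have hω : ∀ θ ∈ Θ₁, |θ.1| ≤ |R| := fun θ hθ =>
    (norm_fst_le θ).trans ((hR θ hθ).trans (le_abs_self R))
  obtain ⟨C, hC, hg⟩ := hh₁.exists_gaussDensity_lipschitz ha |R|
  refine ⟨k * (C + |R| * C), by positivity, fun s t hs ht x hx y => ?_⟩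
  have hst : ∀ i, ‖s i - t i‖ ≤ ‖s - t‖ := fun i => norm_le_pi_norm (s - t) i
  have hgi := fun i => hg x hx (s i).2.1 (Set.mem_image_of_mem _ (hs i)) (t i).2.1
    (Set.mem_image_of_mem _ (ht i)) (s i).2.2 (t i).2.2 ‖s - t‖ y (haΘ _ (hs i)) (hv _ (hs i))
    (haΘ _ (ht i)) (hv _ (ht i))
    ((norm_fst_le (s i - t i).2).trans ((norm_snd_le (s i - t i)).trans (hst i)))
    ((norm_snd_le (s i - t i).2).trans ((norm_snd_le (s i - t i)).trans (hst i)))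
  refine (abs_sum_mul_sub_sum_mul_le (fun i => (norm_fst_le (s i - t i)).trans (hst i))
    (fun i => hω _ (ht i)) (fun i => (hgi i).1) fun i => (hgi i).2).trans (le_of_eq ?_)
  ring

theorem exists_gate_lipschitz {d₂ : ℕ} {Θ₂ : Set (RoutedParam d d₂)} (hΘ₂ : IsCompact Θ₂)
    (h𝒳 : Bornology.IsBounded 𝒳) (k : ℕ) :
    ∃ C : ℝ, 0 ≤ C ∧ ∀ s t : Fin k → RoutedParam d d₂, (∀ i, s i ∈ Θ₂) → (∀ i, t i ∈ Θ₂) →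
      ∀ x ∈ 𝒳, ∀ i, |gate ⟨k, s⟩ x i - gate ⟨k, t⟩ x i| ≤ C * ‖s - t‖ := by
  obtain ⟨R, hR⟩ := hΘ₂.isBounded.exists_norm_le
  obtain ⟨B, hB⟩ := h𝒳.exists_norm_le
  have hb0 : ∀ θ : RoutedParam d d₂, |θ.1| ≤ ‖θ‖ := fun θ => norm_fst_le θ
  have hb1 : ∀ θ : RoutedParam d d₂, ‖θ.2.1‖ ≤ ‖θ‖ := fun θ =>
    (norm_fst_le θ.2).trans (norm_snd_le θ)
  have hlin : ∀ θ : RoutedParam d d₂, ∀ x ∈ 𝒳, |inner ℝ θ.2.1 x + θ.1| ≤ ‖θ‖ * (|B| + 1) := by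
    intro θ x hx
    have h1 : |inner ℝ θ.2.1 x| ≤ ‖θ‖ * |B| := (abs_real_inner_le_norm _ _).trans
      (mul_le_mul (hb1 θ) ((hB x hx).trans (le_abs_self B)) (norm_nonneg _) (norm_nonneg _))
    refine (abs_add_le _ _).trans ?_
    linarith [hb0 θ]
  -- The smallest sigmoid score possible for parameters in `Θ₂` and inputs in `𝒳` is at least `c`,
  -- which keeps the normalizing sum away from `0`.
  set c := Real.sigmoid (-(|R| * (|B| + 1)))
  have hc : 0 < c := Real.sigmoid_pos _
  refine ⟨(k + 1) * (|B| + 1) / c, by positivity, fun s t hs ht x hx i => ?_⟩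
  have key := abs_div_sum_sub_div_sum_le hc
    (w := fun j => Real.sigmoid (inner ℝ (s j).2.1 x + (s j).1))
    (w' := fun j => Real.sigmoid (inner ℝ (t j).2.1 x + (t j).1)) (δ := ‖s - t‖ * (|B| + 1))
    ?_ (fun _ => Real.sigmoid_pos _) ?_ i
  · refine le_of_le_of_eq key ?_
    ring
  · intro j
    refine Real.sigmoid_le ?_
    have h1 := (abs_le.1 (hlin (s j) x hx)).1
    have h2 : ‖s j‖ * (|B| + 1) ≤ |R| * (|B| + 1) :=
      mul_le_mul_of_nonneg_right ((hR _ (hs j)).trans (le_abs_self R)) (by positivity)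
    linarith
  · intro j
    refine (abs_sigmoid_sub_le _ _).trans ?_
    have h1 := hlin (s j - t j) x hx
    have h2 : inner ℝ (s j).2.1 x + (s j).1 - (inner ℝ (t j).2.1 x + (t j).1) =
        inner ℝ (s j - t j).2.1 x + (s j - t j).1 := by
      simp only [Prod.fst_sub, Prod.snd_sub, inner_sub_left]
      ring
    rw [h2]
    exact h1.trans (mul_le_mul_of_nonneg_right (norm_le_pi_norm (s - t) j) (by positivity))

theorem gate_pos {d₂ : ℕ} (G : RoutedMixing d d₂) (x : EuclideanSpace ℝ (Fin d)) (i : Fin G.size) :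
    0 < gate G x i :=
  div_pos (Real.sigmoid_pos _)
    (Finset.sum_pos (fun _ _ => Real.sigmoid_pos _) ⟨i, Finset.mem_univ i⟩)

theorem sum_gate {d₂ : ℕ} (G : RoutedMixing d d₂) (hG : 1 ≤ G.size)
    (x : EuclideanSpace ℝ (Fin d)) : ∑ i, gate G x i = 1 := by
  simp only [gate]
  rw [← Finset.sum_div]
  exact div_self (Finset.sum_pos (fun _ _ => Real.sigmoid_pos _)
    ⟨⟨0, hG⟩, Finset.mem_univ _⟩).ne'

theorem gate_le_one {d₂ : ℕ} (G : RoutedMixing d d₂) (x : EuclideanSpace ℝ (Fin d))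
    (i : Fin G.size) : gate G x i ≤ 1 := by
  rw [← sum_gate G (by have := i.2; omega) x]
  exact Finset.single_le_sum (fun j _ => (gate_pos G x j).le) (Finset.mem_univ i)

theorem exists_routed_lipschitz {d₂ : ℕ}
    {h₂ : EuclideanSpace ℝ (Fin d) → EuclideanSpace ℝ (Fin d₂) → ℝ} {Θ₂ : Set (RoutedParam d d₂)}
    (hΘ₂ : IsCompact Θ₂) (hν : ∀ θ ∈ Θ₂, 0 < θ.2.2.2) (h𝒳 : Bornology.IsBounded 𝒳)
    (hh₂ : IsRegularExpert h₂ 𝒳 ((fun θ : RoutedParam d d₂ => θ.2.2.1) '' Θ₂)) (k : ℕ) :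
    ∃ C : ℝ, 0 ≤ C ∧ ∀ s t : Fin k → RoutedParam d d₂, (∀ i, s i ∈ Θ₂) → (∀ i, t i ∈ Θ₂) →
      ∀ x ∈ 𝒳, ∀ y : ℝ,
        |∑ i, gate ⟨k, s⟩ x i * gaussDensity (h₂ x (s i).2.2.1) (s i).2.2.2 y -
          ∑ i, gate ⟨k, t⟩ x i * gaussDensity (h₂ x (t i).2.2.1) (t i).2.2.2 y| ≤
        C * ‖s - t‖ * (1 + y ^ 2)⁻¹ := by
  obtain ⟨a, ha, haΘ⟩ := hΘ₂.exists_forall_le'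
    (f := fun θ : RoutedParam d d₂ => θ.2.2.2) (by fun_prop) hν
  obtain ⟨R, hR⟩ := hΘ₂.isBounded.exists_norm_le
  have hη : ∀ θ : RoutedParam d d₂, ‖θ.2.2.1‖ ≤ ‖θ‖ := fun θ =>
    (norm_fst_le θ.2.2).trans ((norm_snd_le θ.2).trans (norm_snd_le θ))
  have hνn : ∀ θ : RoutedParam d d₂, |θ.2.2.2| ≤ ‖θ‖ := fun θ =>
    (norm_snd_le θ.2.2).trans ((norm_snd_le θ.2).trans (norm_snd_le θ))
  have hv : ∀ θ ∈ Θ₂, θ.2.2.2 ≤ R := fun θ hθ =>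
    (le_abs_self _).trans ((hνn θ).trans (hR θ hθ))
  obtain ⟨C, hC, hg⟩ := hh₂.exists_gaussDensity_lipschitz ha R
  obtain ⟨C', hC', hgate⟩ := exists_gate_lipschitz hΘ₂ h𝒳 k
  refine ⟨k * (C' * C + C), by positivity, fun s t hs ht x hx y => ?_⟩
  have hst : ∀ i, ‖s i - t i‖ ≤ ‖s - t‖ := fun i => norm_le_pi_norm (s - t) i
  have hgi := fun i => hg x hx (s i).2.2.1 (Set.mem_image_of_mem _ (hs i)) (t i).2.2.1
    (Set.mem_image_of_mem _ (ht i)) (s i).2.2.2 (t i).2.2.2 ‖s - t‖ y (haΘ _ (hs i)) (hv _ (hs i))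
    (haΘ _ (ht i)) (hv _ (ht i)) ((hη (s i - t i)).trans (hst i)) ((hνn (s i - t i)).trans (hst i))
  refine (abs_sum_mul_sub_sum_mul_le (hgate s t hs ht x hx)
    (fun i => (abs_of_pos (gate_pos ⟨k, t⟩ x i)).trans_le (gate_le_one ⟨k, t⟩ x i))
    (fun i => (hgi i).1) fun i => (hgi i).2).trans (le_of_eq ?_)
  ring

end Lipschitz

/-! ### The conditional densities as a class of joint densities. -/

section Density

variable {d d₁ d₂ : ℕ} {h₁ : EuclideanSpace ℝ (Fin d) → EuclideanSpace ℝ (Fin d₁) → ℝ}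
  {h₂ : EuclideanSpace ℝ (Fin d) → EuclideanSpace ℝ (Fin d₂) → ℝ}
  {Θ₁ : Set (SharedParam d₁)} {Θ₂ : Set (RoutedParam d d₂)} {k₁ k₂ : ℕ}
  {G G' : SharedMixing d₁ × RoutedMixing d d₂} {𝒳 : Set (EuclideanSpace ℝ (Fin d))}

theorem condDensity_pos (hτ : ∀ θ ∈ Θ₁, 0 < θ.2.2) (hν : ∀ θ ∈ Θ₂, 0 < θ.2.2.2)
    (hG : G ∈ mixingClass Θ₁ Θ₂ k₁ k₂) (x : EuclideanSpace ℝ (Fin d)) (y : ℝ) :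
    0 < condDensity h₁ h₂ G x y := by
  obtain ⟨⟨hs, -, hΘ, hω, -⟩, ⟨-, -, hΘ'⟩⟩ := hG
  have h1 : 0 < ∑ i, G.1.omega i * gaussDensity (h₁ x (G.1.kappa i)) (G.1.tau i) y :=
    Finset.sum_pos (fun i _ => mul_pos (hω i) (gaussDensity_pos (hτ _ (hΘ i)) y))
      ⟨⟨0, hs⟩, Finset.mem_univ _⟩
  have h2 : 0 ≤ ∑ i, gate G.2 x i * gaussDensity (h₂ x (G.2.eta i)) (G.2.nu i) y :=
    Finset.sum_nonneg fun i _ =>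
      mul_nonneg (gate_pos _ _ _).le (gaussDensity_pos (hν _ (hΘ' i)) y).le
  unfold condDensity
  linarith

theorem measurable_gaussDensity_comp {f : EuclideanSpace ℝ (Fin d) → ℝ} (hf : Measurable f) (v : ℝ) :
    Measurable fun z : EuclideanSpace ℝ (Fin d) × ℝ => gaussDensity (f z.1) v z.2 :=
  measurable_uncurry_gaussianPDFReal.comp
    (f := fun z : EuclideanSpace ℝ (Fin d) × ℝ => (f z.1, v.toNNReal, z.2)) (by fun_prop)

theorem measurable_gate (G : RoutedMixing d d₂) (i : Fin G.size) :
    Measurable fun x => gate G x i := by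
  have h : ∀ j, Measurable fun x : EuclideanSpace ℝ (Fin d) =>
      Real.sigmoid (inner ℝ (G.beta1 j) x + G.beta0 j) := fun j =>
    (continuous_sigmoid.comp (by fun_prop)).measurable
  exact (h i).div (Finset.measurable_fun_sum _ fun j _ => h j)

theorem measurable_condDensity
    (hh₁ : IsRegularExpert h₁ 𝒳 ((fun θ : SharedParam d₁ => θ.2.1) '' Θ₁))
    (hh₂ : IsRegularExpert h₂ 𝒳 ((fun θ : RoutedParam d d₂ => θ.2.2.1) '' Θ₂))
    (hG : G ∈ mixingClass Θ₁ Θ₂ k₁ k₂) :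
    Measurable fun z : EuclideanSpace ℝ (Fin d) × ℝ => condDensity h₁ h₂ G z.1 z.2 := by
  obtain ⟨⟨-, -, hΘ, -, -⟩, ⟨-, -, hΘ'⟩⟩ := hG
  unfold condDensity
  refine Measurable.add (Measurable.const_mul (Finset.measurable_fun_sum _ fun i _ => ?_) _)
    (Measurable.const_mul (Finset.measurable_fun_sum _ fun i _ => ?_) _)
  · exact (measurable_gaussDensity_comp
      (hh₁.measurable _ (Set.mem_image_of_mem _ (hΘ i))) _).const_mul _
  · exact ((measurable_gate G.2 i).comp measurable_fst).mul (measurable_gaussDensity_comp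
      (hh₂.measurable _ (Set.mem_image_of_mem _ (hΘ' i))) _)

theorem integrable_gaussDensity (m v : ℝ) : Integrable fun y => gaussDensity m v y :=
  integrable_gaussianPDFReal _ _

theorem integrable_sum_mul_gaussDensity {k : ℕ} (w m v : Fin k → ℝ) :
    Integrable fun y => ∑ i, w i * gaussDensity (m i) (v i) y :=
  integrable_finsetSum _ fun _ _ => (integrable_gaussDensity _ _).const_mul _

theorem integral_sum_mul_gaussDensity {k : ℕ} {w : Fin k → ℝ} (m : Fin k → ℝ) {v : Fin k → ℝ}
    (hv : ∀ i, 0 < v i) (hw : ∑ i, w i = 1) : ∫ y, ∑ i, w i * gaussDensity (m i) (v i) y = 1 := by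
  rw [integral_finsetSum _ fun i _ => (integrable_gaussDensity _ _).const_mul _, ← hw]
  refine Finset.sum_congr rfl fun i _ => ?_
  rw [integral_const_mul]
  simp only [gaussDensity]
  rw [integral_gaussianPDFReal_eq_one _ (Real.toNNReal_pos.2 (hv i)).ne', mul_one]

theorem lintegral_condDensity (hτ : ∀ θ ∈ Θ₁, 0 < θ.2.2) (hν : ∀ θ ∈ Θ₂, 0 < θ.2.2.2)
    (hG : G ∈ mixingClass Θ₁ Θ₂ k₁ k₂) (x : EuclideanSpace ℝ (Fin d)) :
    ∫⁻ y, ENNReal.ofReal (condDensity h₁ h₂ G x y) = 1 := by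
  have hpos := condDensity_pos (h₁ := h₁) (h₂ := h₂) hτ hν hG x
  obtain ⟨⟨-, -, hΘ, -, hsum⟩, ⟨hs, -, hΘ'⟩⟩ := hG
  have i1 := integrable_sum_mul_gaussDensity G.1.omega (fun i => h₁ x (G.1.kappa i)) G.1.tau
  have i2 := integrable_sum_mul_gaussDensity (gate G.2 x) (fun i => h₂ x (G.2.eta i)) G.2.nu
  have hi : Integrable fun y => condDensity h₁ h₂ G x y := (i1.const_mul _).add (i2.const_mul _)
  rw [← ofReal_integral_eq_lintegral_ofReal hi (ae_of_all _ fun y => (hpos y).le),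
    ENNReal.ofReal_eq_one]
  unfold condDensity
  rw [integral_add (i1.const_mul _) (i2.const_mul _), integral_const_mul, integral_const_mul,
    integral_sum_mul_gaussDensity (v := G.1.tau) _ (fun i => hτ _ (hΘ i)) hsum,
    integral_sum_mul_gaussDensity (v := G.2.nu) _ (fun i => hν _ (hΘ' i))
      (sum_gate G.2 hs x)]
  norm_num

variable {μX : Measure (EuclideanSpace ℝ (Fin d))} [IsProbabilityMeasure μX]

theorem lintegral_prod_condDensity (hτ : ∀ θ ∈ Θ₁, 0 < θ.2.2) (hν : ∀ θ ∈ Θ₂, 0 < θ.2.2.2)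
    (hh₁ : IsRegularExpert h₁ 𝒳 ((fun θ : SharedParam d₁ => θ.2.1) '' Θ₁))
    (hh₂ : IsRegularExpert h₂ 𝒳 ((fun θ : RoutedParam d d₂ => θ.2.2.1) '' Θ₂))
    (hG : G ∈ mixingClass Θ₁ Θ₂ k₁ k₂) :
    ∫⁻ z, ENNReal.ofReal (condDensity h₁ h₂ G z.1 z.2) ∂(μX.prod volume) = 1 := by
  rw [lintegral_prod _ (measurable_condDensity hh₁ hh₂ hG).ennreal_ofReal.aemeasurable]
  simp only [lintegral_condDensity hτ hν hG, lintegral_const, measure_univ, mul_one]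

theorem integrable_condDensity (hτ : ∀ θ ∈ Θ₁, 0 < θ.2.2) (hν : ∀ θ ∈ Θ₂, 0 < θ.2.2.2)
    (hh₁ : IsRegularExpert h₁ 𝒳 ((fun θ : SharedParam d₁ => θ.2.1) '' Θ₁))
    (hh₂ : IsRegularExpert h₂ 𝒳 ((fun θ : RoutedParam d d₂ => θ.2.2.1) '' Θ₂))
    (hG : G ∈ mixingClass Θ₁ Θ₂ k₁ k₂) :
    Integrable (fun z : EuclideanSpace ℝ (Fin d) × ℝ => condDensity h₁ h₂ G z.1 z.2)
      (μX.prod volume) := by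
  rw [← lintegral_ofReal_ne_top_iff_integrable
    (measurable_condDensity hh₁ hh₂ hG).aestronglyMeasurable
    (ae_of_all _ fun z => (condDensity_pos hτ hν hG z.1 z.2).le),
    lintegral_prod_condDensity hτ hν hh₁ hh₂ hG]
  exact ENNReal.one_ne_top

theorem integral_prod_condDensity (hτ : ∀ θ ∈ Θ₁, 0 < θ.2.2) (hν : ∀ θ ∈ Θ₂, 0 < θ.2.2.2)
    (hh₁ : IsRegularExpert h₁ 𝒳 ((fun θ : SharedParam d₁ => θ.2.1) '' Θ₁))
    (hh₂ : IsRegularExpert h₂ 𝒳 ((fun θ : RoutedParam d d₂ => θ.2.2.1) '' Θ₂))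
    (hG : G ∈ mixingClass Θ₁ Θ₂ k₁ k₂) :
    ∫ z, condDensity h₁ h₂ G z.1 z.2 ∂(μX.prod volume) = 1 := by
  have h0 : ∀ z : EuclideanSpace ℝ (Fin d) × ℝ, 0 ≤ condDensity h₁ h₂ G z.1 z.2 :=
    fun z => (condDensity_pos hτ hν hG z.1 z.2).le
  have hm := measurable_condDensity hh₁ hh₂ hG
  rw [integral_eq_lintegral_of_nonneg_ae (ae_of_all _ h0) hm.aestronglyMeasurable,
    lintegral_prod_condDensity hτ hν hh₁ hh₂ hG, ENNReal.toReal_one]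

/-- Tonelli: passes to the `L¹` distance of joint densities that the general rate controls. -/
theorem expectedTV_condDensity (hτ : ∀ θ ∈ Θ₁, 0 < θ.2.2) (hν : ∀ θ ∈ Θ₂, 0 < θ.2.2.2)
    (hh₁ : IsRegularExpert h₁ 𝒳 ((fun θ : SharedParam d₁ => θ.2.1) '' Θ₁))
    (hh₂ : IsRegularExpert h₂ 𝒳 ((fun θ : RoutedParam d d₂ => θ.2.2.1) '' Θ₂))
    (hG : G ∈ mixingClass Θ₁ Θ₂ k₁ k₂) (hG' : G' ∈ mixingClass Θ₁ Θ₂ k₁ k₂) :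
    expectedTV μX (condDensity h₁ h₂ G) (condDensity h₁ h₂ G') = (1 / 2) * ENNReal.ofReal
      (∫ z, |condDensity h₁ h₂ G z.1 z.2 - condDensity h₁ h₂ G' z.1 z.2| ∂(μX.prod volume)) := by
  have hm : Measurable fun z : EuclideanSpace ℝ (Fin d) × ℝ =>
      |condDensity h₁ h₂ G z.1 z.2 - condDensity h₁ h₂ G' z.1 z.2| :=
    ((measurable_condDensity hh₁ hh₂ hG).sub (measurable_condDensity hh₁ hh₂ hG')).norm
  have hi : Integrable (fun z : EuclideanSpace ℝ (Fin d) × ℝ =>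
      |condDensity h₁ h₂ G z.1 z.2 - condDensity h₁ h₂ G' z.1 z.2|) (μX.prod volume) :=
    ((integrable_condDensity hτ hν hh₁ hh₂ hG).sub
      (integrable_condDensity hτ hν hh₁ hh₂ hG')).abs
  rw [ofReal_integral_eq_lintegral_ofReal hi (ae_of_all _ fun z => abs_nonneg _),
    lintegral_prod _ hm.ennreal_ofReal.aemeasurable,
    ← lintegral_const_mul _ hm.ennreal_ofReal.lintegral_prod_right']
  rfl

theorem hasPolynomialCover_mixingClass (hΘ₁ : IsCompact Θ₁) (hΘ₂ : IsCompact Θ₂)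
    (hτ : ∀ θ ∈ Θ₁, 0 < θ.2.2) (hν : ∀ θ ∈ Θ₂, 0 < θ.2.2.2) (h𝒳 : Bornology.IsBounded 𝒳)
    (hh₁ : IsRegularExpert h₁ 𝒳 ((fun θ : SharedParam d₁ => θ.2.1) '' Θ₁))
    (hh₂ : IsRegularExpert h₂ 𝒳 ((fun θ : RoutedParam d d₂ => θ.2.2.1) '' Θ₂)) (k₁ k₂ : ℕ) :
    HasPolynomialCover (fun G (z : EuclideanSpace ℝ (Fin d) × ℝ) => condDensity h₁ h₂ G z.1 z.2)
      {z | z.1 ∈ 𝒳} (fun z => (1 + z.2 ^ 2)⁻¹) (mixingClass Θ₁ Θ₂ k₁ k₂) := by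
  have hF : ∀ z : EuclideanSpace ℝ (Fin d) × ℝ, 0 ≤ (1 + z.2 ^ 2)⁻¹ := fun z => by positivity
  -- For fixed numbers of experts the class is the image of a bounded set of parameter vectors.
  -- Membership includes positivity and normalization of the weights, so cover centres satisfy these
  -- too.
  let B : (j : ℕ × ℕ) → Set ((Fin j.1 → SharedParam d₁) × (Fin j.2 → RoutedParam d d₂)) := fun j =>
    {s | (⟨⟨j.1, s.1⟩, ⟨j.2, s.2⟩⟩ : SharedMixing d₁ × RoutedMixing d d₂) ∈
      mixingClass Θ₁ Θ₂ k₁ k₂}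
  let Φ : (j : ℕ × ℕ) → (Fin j.1 → SharedParam d₁) × (Fin j.2 → RoutedParam d d₂) →
      SharedMixing d₁ × RoutedMixing d d₂ := fun j s => ⟨⟨j.1, s.1⟩, ⟨j.2, s.2⟩⟩
  have hunion : mixingClass Θ₁ Θ₂ k₁ k₂ =
      ⋃ j ∈ Finset.range (k₁ + 1) ×ˢ Finset.range (k₂ + 1), Φ j '' B j := by
    ext G
    simp only [Set.mem_iUnion]
    constructor
    · intro hG
      refine ⟨(G.1.size, G.2.size), ?_, (G.1.atom, G.2.atom), hG, rfl⟩
      have h1 := hG.1.2.1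
      have h2 := hG.2.2.1
      simp only [Finset.mem_product, Finset.mem_range]
      omega
    · rintro ⟨j, -, s, hs, rfl⟩
      exact hs
  rw [hunion]
  refine HasPolynomialCover.biUnion _ hF fun j _ => ?_
  obtain ⟨C, hC, hCl⟩ := exists_shared_lipschitz hΘ₁ hτ hh₁ j.1
  obtain ⟨C', hC', hCl'⟩ := exists_routed_lipschitz hΘ₂ hν h𝒳 hh₂ j.2
  have hbdd : Bornology.IsBounded (B j) := by
    refine ((Bornology.IsBounded.pi fun _ : Fin j.1 => hΘ₁.isBounded).prod
      (Bornology.IsBounded.pi fun _ : Fin j.2 => hΘ₂.isBounded)).subset fun s hs => ?_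
    exact ⟨fun i _ => hs.1.2.2.1 i, fun i _ => hs.2.2.2 i⟩
  refine HasPolynomialCover.image hbdd (Φ j) (add_nonneg hC hC') hF fun s hs t ht z hz => ?_
  have e1 := hCl s.1 t.1 hs.1.2.2.1 ht.1.2.2.1 z.1 hz z.2
  have e2 := hCl' s.2 t.2 hs.2.2.2 ht.2.2.2 z.1 hz z.2
  have e3 : C * ‖s.1 - t.1‖ * (1 + z.2 ^ 2)⁻¹ ≤ C * ‖s - t‖ * (1 + z.2 ^ 2)⁻¹ := by
    gcongr
    exact norm_fst_le (s - t)
  have e4 : C' * ‖s.2 - t.2‖ * (1 + z.2 ^ 2)⁻¹ ≤ C' * ‖s - t‖ * (1 + z.2 ^ 2)⁻¹ := by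
    gcongr
    exact norm_snd_le (s - t)
  have e5 := abs_le.1 (e1.trans e3)
  have e6 := abs_le.1 (e2.trans e4)
  simp only [condDensity, Φ, SharedMixing.omega, SharedMixing.kappa, SharedMixing.tau,
    RoutedMixing.eta, RoutedMixing.nu]
  have e7 : 0 ≤ C * ‖s - t‖ * (1 + z.2 ^ 2)⁻¹ := by positivity
  have e8 : 0 ≤ C' * ‖s - t‖ * (1 + z.2 ^ 2)⁻¹ := by positivity
  rw [abs_le]
  constructor <;> linarith

theorem IsMLE.sum_log_le {n : ℕ} {x : ℕ → EuclideanSpace ℝ (Fin d)} {y : ℕ → ℝ}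
    {𝒢 : Set (SharedMixing d₁ × RoutedMixing d d₂)} (hn : 1 ≤ n)
    (h : IsMLE h₁ h₂ 𝒢 (fun i : Fin n => x i) (fun i : Fin n => y i) G) (hG' : G' ∈ 𝒢) :
    ∑ i ∈ Finset.range n, Real.log (condDensity h₁ h₂ G' (x i) (y i)) ≤
      ∑ i ∈ Finset.range n, Real.log (condDensity h₁ h₂ G (x i) (y i)) := by
  have h1 := h.2 G' hG'
  have hn0 : (0 : ℝ) < n := by exact_mod_cast hn
  rw [Finset.sum_range, Finset.sum_range]
  exact le_of_mul_le_mul_left h1 (by positivity)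

end Density

end DeepSeekMoE

/-! ### The convergence rate. -/

open DeepSeekMoE

theorem mainTheorem7 {d d₁ d₂ : ℕ}
    (h₁ : EuclideanSpace ℝ (Fin d) → EuclideanSpace ℝ (Fin d₁) → ℝ)
    (h₂ : EuclideanSpace ℝ (Fin d) → EuclideanSpace ℝ (Fin d₂) → ℝ)
    -- the parameter spaces are compact, with positive variances, and the input space is bounded
    (Θ₁ : Set (SharedParam d₁)) (Θ₂ : Set (RoutedParam d d₂))
    (hΘ₁ : IsCompact Θ₁) (hΘ₂ : IsCompact Θ₂)
    (hτ : ∀ θ ∈ Θ₁, 0 < θ.2.2) (hν : ∀ θ ∈ Θ₂, 0 < θ.2.2.2)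
    (𝒳 : Set (EuclideanSpace ℝ (Fin d))) (h𝒳 : Bornology.IsBounded 𝒳)
    -- the expert functions are bounded and Lipschitz in their parameters
    (hh₁ : IsRegularExpert h₁ 𝒳 ((fun θ : SharedParam d₁ => θ.2.1) '' Θ₁))
    (hh₂ : IsRegularExpert h₂ 𝒳 ((fun θ : RoutedParam d d₂ => θ.2.2.1) '' Θ₂))
    -- the ground truth has fewer than `k₁` shared and fewer than `k₂` routed experts
    (k₁ k₂ : ℕ) (Gstar : SharedMixing d₁ × RoutedMixing d d₂)
    (hG : Gstar ∈ mixingClass Θ₁ Θ₂ k₁ k₂)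
    (hk₁ : Gstar.1.size < k₁) (hk₂ : Gstar.2.size < k₂)
    -- the data are i.i.d. from the ground-truth model, with inputs in `𝒳`
    (μX : Measure (EuclideanSpace ℝ (Fin d))) [IsProbabilityMeasure μX]
    (hμX : ∀ᵐ x ∂μX, x ∈ 𝒳)
    {Ω : Type*} [MeasurableSpace Ω] (P : Measure Ω) [IsProbabilityMeasure P]
    (X : ℕ → Ω → EuclideanSpace ℝ (Fin d)) (Y : ℕ → Ω → ℝ)
    (hX : ∀ i, Measurable (X i)) (hY : ∀ i, Measurable (Y i))
    (hindep : iIndepFun (fun i ω => (X i ω, Y i ω)) P)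
    (hlaw : ∀ i, P.map (fun ω => (X i ω, Y i ω)) = jointLaw μX (condDensity h₁ h₂ Gstar))
    -- `Ghat n` is a maximum likelihood estimator based on the first `n` observations
    (Ghat : ℕ → Ω → SharedMixing d₁ × RoutedMixing d d₂)
    (hMLE : ∀ n : ℕ, 1 ≤ n → ∀ᵐ ω ∂P, IsMLE h₁ h₂ (mixingClass Θ₁ Θ₂ k₁ k₂)
      (fun i : Fin n => X i ω) (fun i : Fin n => Y i ω) (Ghat n ω)) :
    IsBigOP P
      (fun n ω => expectedTV μX (condDensity h₁ h₂ (Ghat n ω)) (condDensity h₁ h₂ Gstar))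
      (fun n : ℕ => Real.sqrt (Real.log n / n)) := by
  obtain ⟨C, hC, A, D, hcover⟩ := hasPolynomialCover_mixingClass hΘ₁ hΘ₂ hτ hν h𝒳 hh₁ hh₂ k₁ k₂
  have hF : Integrable (fun z : EuclideanSpace ℝ (Fin d) × ℝ => C * (1 + z.2 ^ 2)⁻¹)
      (μX.prod volume) := (integrable_inv_one_add_sq.comp_snd μX).const_mul C
  obtain ⟨M, hM, hrate⟩ := exists_rate_of_cover (μ := μX.prod volume)
    (fun G hG => measurable_condDensity hh₁ hh₂ hG)
    (fun G hG z => condDensity_pos hτ hν hG z.1 z.2)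
    (fun G hG => integrable_condDensity hτ hν hh₁ hh₂ hG)
    (fun G hG => integral_prod_condDensity hτ hν hh₁ hh₂ hG)
    (by fun_prop) hF (fun z => by positivity)
    (Measure.quasiMeasurePreserving_fst.ae hμX) hcover hG
    (fun i => (hX i).prodMk (hY i)) hindep hlaw
  intro ε hε
  refine ⟨M, hM, ?_⟩
  filter_upwards [hrate ε hε, eventually_ge_atTop 1] with n hn hn1
  -- Almost surely the estimator is itself one of the `g` in the uniform bad event, as its
  -- likelihood is at least that of `Gstar`.
  refine lt_of_le_of_lt (measure_mono_ae ?_) hn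
  filter_upwards [hMLE n hn1] with ω hω hlt
  refine ⟨Ghat n ω, hω.1, hω.sum_log_le (x := fun i => X i ω) (y := fun i => Y i ω) hn1 hG, ?_⟩
  have h1 : ENNReal.ofReal (M * Real.sqrt (Real.log n / n)) <
      expectedTV μX (condDensity h₁ h₂ (Ghat n ω)) (condDensity h₁ h₂ Gstar) := hlt
  rw [expectedTV_condDensity hτ hν hh₁ hh₂ hω.1 hG] at h1
  -- The factor `1/2` of the total variation is simply dropped.
  refine (ENNReal.ofReal_lt_ofReal_iff_of_nonneg (by positivity)).1
    (h1.trans_le (mul_le_of_le_one_left zero_le (by simp)))
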